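/- Let $(x_1,y_1),(x_2,y_2)\in(0,1)^2$ with $x_1<x_2$ and $y_2<y_1$, and put $p=((x_1,y_1),(x_2,y_2))$. Let $\mathscr C^0_0$ be the set of continuous maps $f:[0,1]\to[0,1]$ with $f(0)=0$ and $f(1)=1$, with the uniform distance, and let $\Phi_p:\mathscr C^0_0\to\mathscr C^0_0$ be the contraction \[\Phi_p f(x)=\begin{cases} y_1\, f\big(\tfrac{x}{x_1}\big) & x\in[0,x_1],\\ y_1-(y_1-y_2)\, f\big(\tfrac{x-x_1}{x_2-x_1}\big) & x\in[x_1,x_2],\\ y_2+(1-y_2)\, f\big(\tfrac{x-x_2}{1-x_2}\big) & x\in[x_2,1].\end{cases}\] The zipper map $Z_p$ is the unique fixed point of $\Phi_p$. It is called hypersensitive when \[\lambda_{\min}:=\min\Big(\frac{y_1}{x_1},\frac{y_1-y_2}{x_2-x_1},\frac{1-y_2}{1-x_2}\Big)>1 .\] For a measurable map $T:\Omega\to\Omega$, a $T$-invariant probability measure $\mu$ and a finite measurable partition $\xi=(B_1,\dots,B_k)$ of $\Omega$, let $H(\mu;\xi)=-\sum_i\mu(B_i)\log\mu(B_i)$ (with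 $0\log 0=0$) and $h(T,\mu,\xi)=\lim_{n\to\infty}\frac1n H\big(\mu;\xi^{(n)}\big)$, where $\xi^{(n)}$ is the common refinement of the partitions $T^{-j}(\xi)$, $0\le j<n$. The Kolmogorov--Sinai mean dimension of $(T,\mu)$ is \[\operatorname{mdim}_{KS}(T,\mu)=\liminf_{k\to\infty}\ \sup_{\xi\in\mathcal P_k}\frac{h(T,\mu,\xi)}{\log k},\] where $\mathcal P_k$ is the set of measurable partitions of $\Omega$ into at most $k$ subsets. \textbf{Corollary.} Every hypersensitive zipper map $T=Z_p$ admits an invariant Borel probability measure $\mu$ on $[0,1]$ with $\operatorname{mdim}_{KS}(T,\mu)>0$. -/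

import Mathlib

open MeasureTheory Filter Topology unitInterval

/-! ### Zipper maps -/

/-- A pair of points `(x1, y1)`, `(x2, y2)` of the open unit square with `x1 < x2`, `y2 < y1`. -/
structure ZipperParam where
  x1 : ℝ
  y1 : ℝ
  x2 : ℝ
  y2 : ℝ
  x1_pos : 0 < x1
  x1_lt_x2 : x1 < x2
  x2_lt_one : x2 < 1
  y2_pos : 0 < y2
  y2_lt_y1 : y2 < y1
  y1_lt_one : y1 < 1

/-- The continuous self-maps of `[0,1]` that fix `0` and `1`, with the uniform distance. -/
def ZipperSpace : Type := {f : C(I, I) // f 0 = 0 ∧ f 1 = 1}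

noncomputable instance : MetricSpace ZipperSpace :=
  inferInstanceAs (MetricSpace {f : C(I, I) // f 0 = 0 ∧ f 1 = 1})

instance : Nonempty ZipperSpace := ⟨⟨ContinuousMap.id I, rfl, rfl⟩⟩

theorem isClosed_zipperSpace : IsClosed {f : C(I, I) | f 0 = 0 ∧ f 1 = 1} := by
  apply IsClosed.inter
  · exact isClosed_eq (continuous_eval_const (0 : I)) continuous_const
  · exact isClosed_eq (continuous_eval_const (1 : I)) continuous_const

instance : CompleteSpace ZipperSpace := isClosed_zipperSpace.completeSpace_coe

namespace ZipperParam

/-- The evaluation of `f : [0,1] → [0,1]` at a real number; it is only meant for `t ∈ [0,1]`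
(and `t` is first moved to the closest point of `[0,1]` otherwise). -/
noncomputable def ev (f : I → I) (t : ℝ) : ℝ := (f (Set.projIcc 0 1 zero_le_one t) : ℝ)

/-- The three-piece formula for `Φ_p f`. -/
noncomputable def phiFun (p : ZipperParam) (f : I → I) (x : ℝ) : ℝ :=
  if x ≤ p.x1 then p.y1 * ev f (x / p.x1)
  else if x ≤ p.x2 then p.y1 - (p.y1 - p.y2) * ev f ((x - p.x1) / (p.x2 - p.x1))
  else p.y2 + (1 - p.y2) * ev f ((x - p.x2) / (1 - p.x2))

theorem ev_mem (f : I → I) (t : ℝ) : 0 ≤ ev f t ∧ ev f t ≤ 1 :=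
  (f (Set.projIcc 0 1 zero_le_one t)).2

theorem ev_zero (f : I → I) (h : f 0 = 0) : ev f 0 = 0 := by
  simp [ev, h]

theorem ev_one (f : I → I) (h : f 1 = 1) : ev f 1 = 1 := by
  simp [ev, h]

theorem continuous_ev (f : C(I, I)) : Continuous (ev f) :=
  continuous_subtype_val.comp (f.continuous.comp continuous_projIcc)

theorem phiFun_mem (p : ZipperParam) (f : I → I) (x : ℝ) : p.phiFun f x ∈ I := by
  have h1 := p.y2_pos
  have h2 := p.y2_lt_y1
  have h3 := p.y1_lt_one
  unfold phiFun
  split_ifs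
  · have := ev_mem f (x / p.x1)
    constructor <;> nlinarith
  · have := ev_mem f ((x - p.x1) / (p.x2 - p.x1))
    constructor <;> nlinarith
  · have := ev_mem f ((x - p.x2) / (1 - p.x2))
    constructor <;> nlinarith

theorem continuous_phiFun (p : ZipperParam) (f : ZipperSpace) :
    Continuous (p.phiFun f.1) := by
  have h1 := p.x1_pos
  have h2 := p.x1_lt_x2
  have h3 := p.x2_lt_one
  have hc := continuous_ev f.1
  have e0 := ev_zero f.1 f.2.1
  have e1 := ev_one f.1 f.2.2
  unfold phiFun
  refine Continuous.if_le (by fun_prop) ?_ continuous_id continuous_const ?_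
  · refine Continuous.if_le (by fun_prop) (by fun_prop) continuous_id continuous_const ?_
    intro x hx
    have hx2 : x = p.x2 := hx
    subst hx2
    have : p.x2 - p.x1 ≠ 0 := by linarith
    simp [div_self this, e0, e1]
  · rintro x rfl
    simp [div_self h1.ne', h2.le, e0, e1]

/-- The operator `Φ_p`. -/
noncomputable def phi (p : ZipperParam) (f : ZipperSpace) : ZipperSpace :=
  ⟨⟨fun x => ⟨p.phiFun f.1 x, p.phiFun_mem f.1 x⟩,
    ((p.continuous_phiFun f).comp continuous_subtype_val).subtype_mk _⟩, by
    have h1 := p.x1_pos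
    have e0 := ev_zero f.1 f.2.1
    apply Subtype.ext
    simp [phiFun, h1.le, e0], by
    have h2 := p.x1_lt_x2
    have h3 := p.x2_lt_one
    have e1 := ev_one f.1 f.2.2
    have : (1 : ℝ) - p.x2 ≠ 0 := by linarith
    apply Subtype.ext
    simp [phiFun, not_le.2 h3, not_le.2 (h2.trans h3), div_self this, e1]⟩

/-- `max (y1, y1 - y2, 1 - y2)`, the contraction ratio of `Φ_p`. -/
noncomputable def vMax (p : ZipperParam) : ℝ := max p.y1 (max (p.y1 - p.y2) (1 - p.y2))

theorem vMax_nonneg (p : ZipperParam) : 0 ≤ p.vMax :=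
  (p.y2_pos.trans p.y2_lt_y1).le.trans (le_max_left _ _)

theorem vMax_lt_one (p : ZipperParam) : p.vMax < 1 := by
  have h1 := p.y2_pos
  have h3 := p.y1_lt_one
  exact max_lt h3 (max_lt (by linarith) (by linarith))

theorem abs_phiFun_sub_le (p : ZipperParam) (f g : ZipperSpace) (x : ℝ) :
    |p.phiFun f.1 x - p.phiFun g.1 x| ≤ p.vMax * dist f g := by
  have h1 := p.y2_pos
  have h2 := p.y2_lt_y1
  have h3 := p.y1_lt_one
  have key : ∀ t, |ev f.1 t - ev g.1 t| ≤ dist f g := fun t =>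
    ContinuousMap.dist_apply_le_dist (f := f.1) (g := g.1) (Set.projIcc 0 1 zero_le_one t)
  have hv1 : p.y1 ≤ p.vMax := le_max_left _ _
  have hv2 : p.y1 - p.y2 ≤ p.vMax := (le_max_left _ _).trans (le_max_right _ _)
  have hv3 : 1 - p.y2 ≤ p.vMax := (le_max_right _ _).trans (le_max_right _ _)
  have aux : ∀ c t, 0 ≤ c → c ≤ p.vMax →
      |c * (ev f.1 t - ev g.1 t)| ≤ p.vMax * dist f g := by
    intro c t hc hcv
    rw [abs_mul, abs_of_nonneg hc]
    exact mul_le_mul hcv (key t) (abs_nonneg _) p.vMax_nonneg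
  unfold phiFun
  split_ifs
  · have := aux p.y1 (x / p.x1) (by linarith) hv1
    rwa [mul_sub] at this
  · have := aux (p.y1 - p.y2) ((x - p.x1) / (p.x2 - p.x1)) (by linarith) hv2
    rw [abs_sub_comm]
    convert this using 2
    ring
  · have := aux (1 - p.y2) ((x - p.x2) / (1 - p.x2)) (by linarith) hv3
    convert this using 2
    ring

theorem contracting_phi (p : ZipperParam) :
    ContractingWith ⟨p.vMax, p.vMax_nonneg⟩ p.phi := by
  refine ⟨p.vMax_lt_one, LipschitzWith.of_dist_le_mul fun f g => ?_⟩
  refine (ContinuousMap.dist_le (mul_nonneg p.vMax_nonneg dist_nonneg)).2 fun x => ?_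
  exact p.abs_phiFun_sub_le f g x

/-- The zipper map `Z_p : [0,1] → [0,1]`, the unique fixed point of the contraction `Φ_p`. -/
noncomputable def zipperMap (p : ZipperParam) : C(I, I) :=
  (ContractingWith.fixedPoint p.phi p.contracting_phi).1

theorem zipperMap_apply (p : ZipperParam) (x : I) :
    (p.zipperMap x : ℝ) = p.phiFun p.zipperMap x := by
  have h : p.phi (ContractingWith.fixedPoint p.phi p.contracting_phi) = _ :=
    p.contracting_phi.fixedPoint_isFixedPt
  exact (congrArg (fun g : ZipperSpace => (g.1 x : ℝ)) h).symm

/-- The smallest absolute slope of the piecewise affine map `Φ_p(Id)`. -/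
noncomputable def lambdaMin (p : ZipperParam) : ℝ :=
  min (p.y1 / p.x1) (min ((p.y1 - p.y2) / (p.x2 - p.x1)) ((1 - p.y2) / (1 - p.x2)))

/-- The hypersensitive case: all slopes of `Φ_p(Id)` exceed `1` in absolute value. -/
def Hypersensitive (p : ZipperParam) : Prop := 1 < p.lambdaMin

end ZipperParam

/-! ### Entropy and Kolmogorov-Sinai mean dimension

A measurable partition into at most `k` sets is given by a measurable labelling `ξ : Ω → Fin k`:
its cells are the sets `ξ ⁻¹' {i}`, some of which may be empty. -/

section Entropy

/-- The entropy `-∑ μ(B) log μ(B)` of the finite partition into the fibres `B` of `ξ`. -/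
noncomputable def partitionEntropy {Ω α : Type*} [MeasurableSpace Ω] [Fintype α]
    (μ : Measure Ω) (ξ : Ω → α) : ℝ :=
  ∑ a, Real.negMulLog (μ.real (ξ ⁻¹' {a}))

/-- The common refinement of the partitions `T⁻ʲ(ξ)`, `0 ≤ j < n`. -/
def itinerary {Ω α : Type*} (T : Ω → Ω) (ξ : Ω → α) (n : ℕ) : Ω → (Fin n → α) :=
  fun x j => ξ (T^[j] x)

/-- The entropy `h(T, μ, ξ)` relative to the partition `ξ`. For an invariant probability measure
and a measurable partition the limit exists: see `tendsto_entropyRate`. -/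
noncomputable def entropyRate {Ω : Type*} [MeasurableSpace Ω] {k : ℕ}
    (T : Ω → Ω) (μ : Measure Ω) (ξ : Ω → Fin k) : ℝ :=
  limUnder atTop fun n : ℕ => partitionEntropy μ (itinerary T ξ n) / n

/-- The Kolmogorov-Sinai mean dimension: the lower limit, as `k → ∞`, of the supremum of
`h(T, μ, ξ) / log k` over the measurable partitions `ξ` into at most `k` sets. -/
noncomputable def ksMeanDim {Ω : Type*} [MeasurableSpace Ω] (T : Ω → Ω) (μ : Measure Ω) : EReal :=
  liminf (fun k : ℕ => ⨆ ξ : {ξ : Ω → Fin k // Measurable ξ},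
    ((entropyRate T μ ξ.1 / Real.log k : ℝ) : EReal)) atTop

variable {Ω : Type*} [MeasurableSpace Ω]

theorem partitionEntropy_nonneg {α : Type*} [Fintype α] (μ : Measure Ω) [IsProbabilityMeasure μ]
    (ξ : Ω → α) : 0 ≤ partitionEntropy μ ξ :=
  Finset.sum_nonneg fun _ _ => Real.negMulLog_nonneg measureReal_nonneg measureReal_le_one

theorem partitionEntropy_comp_equiv {α β : Type*} [Fintype α] [Fintype β] (μ : Measure Ω)
    (ξ : Ω → α) (e : α ≃ β) : partitionEntropy μ (e ∘ ξ) = partitionEntropy μ ξ := by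
  unfold partitionEntropy
  rw [← e.sum_comp]
  refine Finset.sum_congr rfl fun a _ => ?_
  congr 2
  ext x
  simp

theorem sum_measureReal_inter_fibre {γ : Type*} [Fintype γ] [MeasurableSpace γ]
    [MeasurableSingletonClass γ] (μ : Measure Ω) [IsProbabilityMeasure μ] {ζ : Ω → γ}
    (hζ : Measurable ζ) (S : Set Ω) (hS : MeasurableSet S) :
    ∑ c, μ.real (S ∩ ζ ⁻¹' {c}) = μ.real S := by
  rw [← measureReal_iUnion_fintype]
  · congr 1
    ext x
    simp
  · intro c d hcd
    refine Set.disjoint_left.2 fun x hx hy => hcd ?_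
    simp only [Set.mem_inter_iff, Set.mem_preimage, Set.mem_singleton_iff] at hx hy
    exact hx.2.symm.trans hy.2
  · exact fun c => hS.inter (hζ (measurableSet_singleton c))

theorem partitionEntropy_prod_le {α β : Type*} [Fintype α] [Fintype β]
    [MeasurableSpace α] [MeasurableSpace β] [MeasurableSingletonClass α]
    [MeasurableSingletonClass β] (μ : Measure Ω) [IsProbabilityMeasure μ]
    {ξ : Ω → α} {η : Ω → β} (hξ : Measurable ξ) (hη : Measurable η) :
    partitionEntropy μ (fun x => (ξ x, η x)) ≤ partitionEntropy μ ξ + partitionEntropy μ η := by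
  have hA : ∀ a, MeasurableSet (ξ ⁻¹' {a}) := fun a => hξ (measurableSet_singleton a)
  have hB : ∀ b, MeasurableSet (η ⁻¹' {b}) := fun b => hη (measurableSet_singleton b)
  have hset : ∀ a b, (fun x => (ξ x, η x)) ⁻¹' {(a, b)} = ξ ⁻¹' {a} ∩ η ⁻¹' {b} := by
    intro a b
    ext x
    simp
  set p : α → ℝ := fun a => μ.real (ξ ⁻¹' {a}) with hp
  set q : β → ℝ := fun b => μ.real (η ⁻¹' {b}) with hq
  set P : α → β → ℝ := fun a b => μ.real (ξ ⁻¹' {a} ∩ η ⁻¹' {b}) with hP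
  have sumb : ∀ a, ∑ b, P a b = p a := fun a => sum_measureReal_inter_fibre μ hη _ (hA a)
  have suma : ∀ b, ∑ a, P a b = q b := by
    intro b
    refine Eq.trans ?_ (sum_measureReal_inter_fibre μ hξ _ (hB b))
    exact Finset.sum_congr rfl fun a _ => by rw [hP, Set.inter_comm]
  have sump : ∑ a, p a = 1 := by
    have := sum_measureReal_inter_fibre μ hξ Set.univ MeasurableSet.univ
    simpa using this
  have sumq : ∑ b, q b = 1 := by
    have := sum_measureReal_inter_fibre μ hη Set.univ MeasurableSet.univ
    simpa using this
  have term : ∀ a b, Real.negMulLog (P a b) ≤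
      -(P a b * Real.log (p a)) - P a b * Real.log (q b) + (p a * q b - P a b) := by
    intro a b
    have h0 : 0 ≤ P a b := measureReal_nonneg
    have hpa : P a b ≤ p a := measureReal_mono Set.inter_subset_left
    have hqb : P a b ≤ q b := measureReal_mono Set.inter_subset_right
    rcases h0.eq_or_lt with h | h
    · rw [← h] at hpa hqb ⊢
      simpa using mul_nonneg hpa hqb
    · have h1 : 0 < p a := h.trans_le hpa
      have h2 : 0 < q b := h.trans_le hqb
      have h3 := Real.log_le_sub_one_of_pos (div_pos (mul_pos h1 h2) h)
      rw [Real.log_div (mul_pos h1 h2).ne' h.ne', Real.log_mul h1.ne' h2.ne'] at h3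
      have h4 := mul_le_mul_of_nonneg_left h3 h.le
      have h5 : P a b * (p a * q b / P a b - 1) = p a * q b - P a b := by
        field_simp
      rw [h5] at h4
      unfold Real.negMulLog
      linarith
  have step : partitionEntropy μ (fun x => (ξ x, η x)) ≤ ∑ a, ∑ b,
      (-(P a b * Real.log (p a)) - P a b * Real.log (q b) + (p a * q b - P a b)) := by
    unfold partitionEntropy
    rw [Fintype.sum_prod_type]
    refine Finset.sum_le_sum fun a _ => Finset.sum_le_sum fun b _ => ?_
    rw [hset]
    exact term a b
  refine step.trans (le_of_eq ?_)
  have e1 : ∑ a, ∑ b, P a b * Real.log (p a) = ∑ a, p a * Real.log (p a) :=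
    Finset.sum_congr rfl fun a _ => by rw [← Finset.sum_mul, sumb]
  have e2 : ∑ a, ∑ b, P a b * Real.log (q b) = ∑ b, q b * Real.log (q b) := by
    rw [Finset.sum_comm]
    exact Finset.sum_congr rfl fun b _ => by rw [← Finset.sum_mul, suma]
  have e3 : ∑ a, ∑ b, p a * q b = 1 := by
    rw [← Finset.sum_mul_sum, sump, sumq, one_mul]
  have e4 : ∑ a, ∑ b, P a b = 1 := by
    rw [← sump]
    exact Finset.sum_congr rfl fun a _ => sumb a
  simp only [Finset.sum_add_distrib, Finset.sum_sub_distrib, Finset.sum_neg_distrib, e1, e2, e3, e4]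
  simp only [partitionEntropy, Real.negMulLog, neg_mul, Finset.sum_neg_distrib]
  ring

theorem measurable_itinerary {k : ℕ} {T : Ω → Ω} {ξ : Ω → Fin k} (hT : Measurable T)
    (hξ : Measurable ξ) (n : ℕ) : Measurable (itinerary T ξ n) :=
  measurable_pi_lambda _ fun j => hξ.comp (hT.iterate j)

theorem partitionEntropy_comp_measurePreserving {α : Type*} [Fintype α] [MeasurableSpace α]
    [MeasurableSingletonClass α] {μ : Measure Ω} {S : Ω → Ω} (hS : MeasurePreserving S μ μ)
    {ξ : Ω → α} (hξ : Measurable ξ) : partitionEntropy μ (ξ ∘ S) = partitionEntropy μ ξ := by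
  unfold partitionEntropy
  refine Finset.sum_congr rfl fun a _ => ?_
  rw [Set.preimage_comp, hS.measureReal_preimage (hξ (measurableSet_singleton a)).nullMeasurableSet]

theorem subadditive_partitionEntropy {k : ℕ} {T : Ω → Ω} {μ : Measure Ω} [IsProbabilityMeasure μ]
    (hT : MeasurePreserving T μ μ) {ξ : Ω → Fin k} (hξ : Measurable ξ) :
    Subadditive fun n => partitionEntropy μ (itinerary T ξ n) := by
  intro m n
  have hm := measurable_itinerary hT.measurable hξ m
  have hn := measurable_itinerary hT.measurable hξ n
  have h1 : itinerary T ξ (m + n) = Fin.appendEquiv m n ∘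
      fun x => (itinerary T ξ m x, (itinerary T ξ n ∘ T^[m]) x) := by
    ext x j
    refine Fin.addCases (fun i => ?_) (fun i => ?_) j
    · simp [itinerary]
    · simp [itinerary, Function.iterate_add_apply, Nat.add_comm m]
  calc partitionEntropy μ (itinerary T ξ (m + n))
      = partitionEntropy μ (fun x => (itinerary T ξ m x, (itinerary T ξ n ∘ T^[m]) x)) := by
        rw [h1, partitionEntropy_comp_equiv]
    _ ≤ partitionEntropy μ (itinerary T ξ m) + partitionEntropy μ (itinerary T ξ n ∘ T^[m]) :=
        partitionEntropy_prod_le μ hm (hn.comp (hT.measurable.iterate m))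
    _ = _ := by rw [partitionEntropy_comp_measurePreserving (hT.iterate m) hn]

/-- The limit that defines `entropyRate` exists. -/
theorem tendsto_entropyRate {k : ℕ} {T : Ω → Ω} {μ : Measure Ω} [IsProbabilityMeasure μ]
    (hT : MeasurePreserving T μ μ) {ξ : Ω → Fin k} (hξ : Measurable ξ) :
    Tendsto (fun n : ℕ => partitionEntropy μ (itinerary T ξ n) / n) atTop
      (𝓝 (entropyRate T μ ξ)) := by
  refine tendsto_nhds_limUnder ⟨_, (subadditive_partitionEntropy hT hξ).tendsto_lim ⟨0, ?_⟩⟩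
  rintro _ ⟨n, rfl⟩
  exact div_nonneg (partitionEntropy_nonneg μ _) n.cast_nonneg

end Entropy

/-! The zipper map reproduces itself affinely on three pieces, with slope ratios at least `lambdaMin
> 1`. On a piece of depth `n` its increment is therefore at least `lambdaMin ^ n` times the length,
so at small scales the map stretches every interval by an arbitrarily large factor
(`Hypersensitive.exists_growth`). A tiny interval then reaches a fixed size in a time much smaller
than the logarithm of its inverse length. Packing tiny intervals into grid cells and applying the
pigeonhole principle gives one set `V` which, for every `R`, contains `exp (R * n)` disjoint closed
sets mapped over `V` by `T^[n]`, for some `n` (`exists_horseshoe_of_growth`).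

The measure is built backwards. From a point mass on `V`, preimages are chosen uniformly among the
branches of these horseshoes. Since `V` does not depend on `R`, horseshoes of all rates can be
interleaved hierarchically, so that most distributions of a long backward orbit are spread along the
fibres of `T^[B j]` at rate `j`, for every `j` below a given bound (`exists_backward_blocks`).
Averages along longer and longer backward orbits accumulate at an invariant `μ` that inherits this
(`exists_invariant_limit`): given the future, a past of suitable length `m` has conditional
probabilities below `exp (-R * m)`, for every `R` (`HasSpreadFibres`).

It remains to exhibit, for each `k`, a partition into `k` sets with entropy comparable to `log k`. A
random colouring of a sufficiently fine partition does this. Two pasts that do not meet at a common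
time receive equal colours with probability at most `k ^ (-m / 2)`, and by the spread of the fibres
pasts that do meet carry little weight. A small collision probability bounds the conditional entropy
given the future from below, and the chain rule turns this bound into entropy rate at least `log k /
8 - 1`. -/

/-! ### Entropy inequalities -/

/-- If `u` is injective and `u t ≠ u' t` for all `t < m`, then a proportion of at most `k ^ (-m / 2)`
of the functions `ρ : Z → Fin k` satisfies `ρ ∘ u = ρ ∘ u'`. -/
theorem card_colouring_sq_mul_le {Z : Type*} [Fintype Z] [DecidableEq Z] {k m : ℕ} (hk : 0 < k)
    (u u' : Fin m → Z) (hu : Function.Injective u) (hne : ∀ t, u t ≠ u' t) :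
    (Finset.univ.filter fun ρ : Z → Fin k => ∀ t, ρ (u t) = ρ (u' t)).card ^ 2 * k ^ m ≤
      (k ^ Fintype.card Z) ^ 2 := by
  classical
  -- The colourings in question are those constant on the classes of the equivalence relation
  -- generated by `u t ∼ u' t`, so it suffices to bound the number of classes.
  let r : Setoid Z := Relation.EqvGen.setoid fun a b => ∃ t, a = u t ∧ b = u' t
  have hr : ∀ t, r (u t) (u' t) := fun t => Relation.EqvGen.rel _ _ ⟨t, rfl, rfl⟩
  have hlift : ∀ ρ : Z → Fin k, (∀ t, ρ (u t) = ρ (u' t)) → ∀ a b, r a b → ρ a = ρ b := by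
    intro ρ hρ a b hab
    induction hab with
    | rel x y h => obtain ⟨t, rfl, rfl⟩ := h; exact hρ t
    | refl => rfl
    | symm _ _ _ ih => exact ih.symm
    | trans _ _ _ _ _ ih1 ih2 => exact ih1.trans ih2
  have h1 : (Finset.univ.filter fun ρ : Z → Fin k => ∀ t, ρ (u t) = ρ (u' t)).card ≤
      k ^ Fintype.card (Quotient r) := by
    have : (Finset.univ.filter fun ρ : Z → Fin k => ∀ t, ρ (u t) = ρ (u' t)) ⊆
        Finset.univ.image fun w : Quotient r → Fin k => fun z => w (Quotient.mk r z) := by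
      intro ρ hρ
      simp only [Finset.mem_filter, Finset.mem_univ, true_and] at hρ
      simp only [Finset.mem_image, Finset.mem_univ, true_and]
      exact ⟨Quotient.lift ρ (hlift ρ hρ), rfl⟩
    refine (Finset.card_le_card this).trans (Finset.card_image_le.trans ?_)
    simp
  have h2 : 2 * Fintype.card (Quotient r) + m ≤ 2 * Fintype.card Z := by
    let U : Finset Z := Finset.univ.image u
    have hU : U.card = m := by
      rw [Finset.card_image_of_injective _ hu]
      simp
    have e1 : Fintype.card Z = ∑ c : Quotient r,
        (Finset.univ.filter fun z => Quotient.mk r z = c).card :=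
      Finset.card_eq_sum_card_fiberwise (s := Finset.univ) (t := Finset.univ) (by simp)
    have e2 : Uᶜ.card = ∑ c : Quotient r, (Uᶜ.filter fun z => Quotient.mk r z = c).card :=
      Finset.card_eq_sum_card_fiberwise (by simp)
    -- A class that meets the range `U` of `u` contains two points `u t ≠ u' t`. A class that misses
    -- `U` is counted in full by both terms. The right side adds up to `2 * card Z - m`.
    have e3 : ∑ _c : Quotient r, 2 ≤ ∑ c : Quotient r,
        ((Finset.univ.filter fun z => Quotient.mk r z = c).card +
          (Uᶜ.filter fun z => Quotient.mk r z = c).card) := by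
      refine Finset.sum_le_sum fun c _ => ?_
      by_cases hc : ∃ t, Quotient.mk r (u t) = c
      · obtain ⟨t, rfl⟩ := hc
        have : ({u t, u' t} : Finset Z) ⊆
            Finset.univ.filter fun z => Quotient.mk r z = Quotient.mk r (u t) := by
          intro z hz
          simp only [Finset.mem_insert, Finset.mem_singleton] at hz
          simp only [Finset.mem_filter, Finset.mem_univ, true_and]
          rcases hz with rfl | rfl
          · rfl
          · exact Quotient.sound (r.symm (hr t))
        have := Finset.card_le_card this
        rw [Finset.card_pair (hne t)] at this
        omega
      · obtain ⟨z, rfl⟩ := Quotient.exists_rep c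
        have hz : z ∉ U := by
          intro hz
          obtain ⟨t, -, rfl⟩ := Finset.mem_image.1 hz
          exact hc ⟨t, rfl⟩
        have a1 : 0 < (Finset.univ.filter fun y => Quotient.mk r y = Quotient.mk r z).card :=
          Finset.card_pos.2 ⟨z, by simp⟩
        have a2 : 0 < (Uᶜ.filter fun y => Quotient.mk r y = Quotient.mk r z).card :=
          Finset.card_pos.2 ⟨z, by simp [hz]⟩
        omega
    rw [Finset.sum_add_distrib, ← e1, ← e2, Finset.card_compl, hU] at e3
    have : m ≤ Fintype.card Z := by
      rw [← hU]
      exact Finset.card_le_univ U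
    simp at e3
    omega
  calc _ ≤ (k ^ Fintype.card (Quotient r)) ^ 2 * k ^ m := by gcongr
    _ = k ^ (2 * Fintype.card (Quotient r) + m) := by ring
    _ ≤ k ^ (2 * Fintype.card Z) := Nat.pow_le_pow_right hk h2
    _ = _ := by ring

/-- A lower bound for the conditional entropy of a joint distribution `P` in terms of a weighted
collision probability. -/
theorem le_condEntropy_of_collision {α β : Type*} [Fintype α] [Fintype β] {P G : α → β → ℝ}
    {M : β → ℝ} (hG0 : ∀ a b, 0 ≤ G a b) (hGP : ∀ a b, G a b ≤ P a b)
    (hM : ∀ b, ∑ a, P a b = M b) {c : ℝ} (hc : 0 < c)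
    (hC : ∑ a, ∑ b, G a b * P a b / M b ≤ c) :
    (∑ a, ∑ b, G a b) * (1 - Real.log c) - 1 ≤
      ∑ a, ∑ b, Real.negMulLog (P a b) - ∑ b, Real.negMulLog (M b) := by
  have hP0 : ∀ a b, 0 ≤ P a b := fun a b => (hG0 a b).trans (hGP a b)
  have hPM : ∀ a b, P a b ≤ M b := fun a b => by
    rw [← hM b]
    exact Finset.single_le_sum (f := fun a => P a b) (fun a _ => hP0 a b) (Finset.mem_univ a)
  -- Two estimates are combined: `log (P / M) ≤ 0` lets `G` replace `P` as the weight, and the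
  -- tangent of `log` at `c` bounds `log (P / M)` by `P / M / c - 1 + log c`.
  have term : ∀ a b, G a b * (1 - Real.log c) - G a b * P a b / M b / c ≤
      Real.negMulLog (P a b) + P a b * Real.log (M b) := by
    intro a b
    rcases (hP0 a b).eq_or_lt with h | h
    · have : G a b = 0 := le_antisymm ((hGP a b).trans h.ge) (hG0 a b)
      simp [this, ← h]
    · have hMb := h.trans_le (hPM a b)
      have hr : 0 < P a b / M b := div_pos h hMb
      have l1 := Real.log_le_sub_one_of_pos (div_pos hr hc)
      have l2 : Real.log (P a b / M b) ≤ 0 :=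
        Real.log_nonpos hr.le ((div_le_one hMb).2 (hPM a b))
      rw [Real.log_div hr.ne' hc.ne'] at l1
      have l3 := mul_le_mul_of_nonneg_left l1 (hG0 a b)
      have l4 := mul_le_mul_of_nonpos_right (hGP a b) l2
      have l5 : P a b * Real.log (P a b / M b) = P a b * Real.log (P a b) - P a b * Real.log (M b) := by
        rw [Real.log_div h.ne' hMb.ne']
        ring
      have l6 : G a b * (P a b / M b / c - 1) = G a b * P a b / M b / c - G a b := by ring
      rw [l6] at l3
      unfold Real.negMulLog
      nlinarith
  have hsum := Finset.sum_le_sum fun a (_ : a ∈ Finset.univ) =>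
    Finset.sum_le_sum fun b (_ : b ∈ Finset.univ) => term a b
  simp only [Finset.sum_sub_distrib, Finset.sum_add_distrib, ← Finset.sum_mul,
    ← Finset.sum_div] at hsum
  have e : ∑ a, ∑ b, P a b * Real.log (M b) = - ∑ b, Real.negMulLog (M b) := by
    rw [Finset.sum_comm, ← Finset.sum_neg_distrib]
    refine Finset.sum_congr rfl fun b _ => ?_
    rw [← Finset.sum_mul, hM, Real.negMulLog]
    ring
  rw [e] at hsum
  have : (∑ a, ∑ b, G a b * P a b / M b) / c ≤ 1 := (div_le_one hc).2 hC
  linarith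

/-- Conditional entropy increases when the condition becomes coarser. -/
theorem condEntropy_le_condEntropy_comp {α β γ : Type*} [Fintype α] [Fintype β] [Fintype γ]
    [DecidableEq γ] {P : α → β → ℝ} {M : β → ℝ} (hP0 : ∀ a b, 0 ≤ P a b)
    (hM : ∀ b, ∑ a, P a b = M b) (φ : β → γ) {P' : α → γ → ℝ} {M' : γ → ℝ}
    (hP' : ∀ a c, P' a c = ∑ b with φ b = c, P a b) (hM' : ∀ c, M' c = ∑ b with φ b = c, M b) :
    ∑ a, ∑ b, Real.negMulLog (P a b) - ∑ b, Real.negMulLog (M b) ≤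
      ∑ a, ∑ c, Real.negMulLog (P' a c) - ∑ c, Real.negMulLog (M' c) := by
  have hM0 : ∀ b, 0 ≤ M b := fun b => hM b ▸ Finset.sum_nonneg fun a _ => hP0 a b
  have hPM : ∀ a b, P a b ≤ M b := fun a b => by
    rw [← hM b]
    exact Finset.single_le_sum (f := fun a => P a b) (fun a _ => hP0 a b) (Finset.mem_univ a)
  have hPP : ∀ a b, P a b ≤ P' a (φ b) := fun a b => by
    rw [hP']
    exact Finset.single_le_sum (f := fun b => P a b) (fun b _ => hP0 a b) (by simp)
  have hMM : ∀ b, M b ≤ M' (φ b) := fun b => by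
    rw [hM']
    exact Finset.single_le_sum (f := M) (fun b _ => hM0 b) (by simp)
  have hPM' : ∀ c, ∑ a, P' a c = M' c := fun c => by
    simp only [hP', hM']
    rw [Finset.sum_comm]
    exact Finset.sum_congr rfl fun b _ => hM b
  -- Gibbs' inequality, termwise: `P` is compared with `P' * M / M'`, the joint law that makes `a`
  -- and `b` independent given `φ b`. Its total mass is at most that of `P`.
  have term : ∀ a b, Real.negMulLog (P a b) + P a b * Real.log (M b) ≤
      (-(P a b * Real.log (P' a (φ b))) + P a b * Real.log (M' (φ b))) +
        (P' a (φ b) * (M b / M' (φ b)) - P a b) := by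
    intro a b
    rcases (hP0 a b).eq_or_lt with h | h
    · rw [← h]
      simp only [Real.negMulLog_zero, zero_mul, neg_zero, add_zero, zero_add, sub_zero]
      exact mul_nonneg ((hP0 a b).trans (hPP a b)) (div_nonneg (hM0 b) ((hM0 b).trans (hMM b)))
    · have h1 := h.trans_le (hPP a b)
      have h2 := h.trans_le (hPM a b)
      have h3 := h2.trans_le (hMM b)
      have l1 := Real.log_le_sub_one_of_pos (div_pos (mul_pos h1 (div_pos h2 h3)) h)
      rw [Real.log_div (mul_pos h1 (div_pos h2 h3)).ne' h.ne', Real.log_mul h1.ne' (div_pos h2 h3).ne',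
        Real.log_div h2.ne' h3.ne'] at l1
      have l2 := mul_le_mul_of_nonneg_left l1 h.le
      have l3 : P a b * (P' a (φ b) * (M b / M' (φ b)) / P a b - 1) =
          P' a (φ b) * (M b / M' (φ b)) - P a b := by field_simp
      rw [l3] at l2
      unfold Real.negMulLog
      linarith
  have hsum := Finset.sum_le_sum fun a (_ : a ∈ Finset.univ) =>
    Finset.sum_le_sum fun b (_ : b ∈ Finset.univ) => term a b
  simp only [Finset.sum_sub_distrib, Finset.sum_add_distrib, Finset.sum_neg_distrib] at hsum
  have e1 : ∑ a, ∑ b, P a b * Real.log (M b) = - ∑ b, Real.negMulLog (M b) := by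
    rw [Finset.sum_comm, ← Finset.sum_neg_distrib]
    refine Finset.sum_congr rfl fun b _ => ?_
    rw [← Finset.sum_mul, hM, Real.negMulLog]
    ring
  have e2 : ∑ a, ∑ b, P a b * Real.log (P' a (φ b)) = - ∑ a, ∑ c, Real.negMulLog (P' a c) := by
    rw [← Finset.sum_neg_distrib]
    refine Finset.sum_congr rfl fun a _ => ?_
    rw [← Finset.sum_neg_distrib, ← Finset.sum_fiberwise (s := Finset.univ) (g := φ)]
    refine Finset.sum_congr rfl fun c _ => ?_
    rw [Real.negMulLog, neg_mul, neg_neg, hP' a c, Finset.sum_mul]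
    refine Finset.sum_congr rfl fun b hb => ?_
    rw [(Finset.mem_filter.1 hb).2, hP' a c]
  have e3 : ∑ a, ∑ b, P a b * Real.log (M' (φ b)) = - ∑ c, Real.negMulLog (M' c) := by
    rw [Finset.sum_comm, ← Finset.sum_neg_distrib, ← Finset.sum_fiberwise (s := Finset.univ) (g := φ)]
    refine Finset.sum_congr rfl fun c _ => ?_
    rw [Real.negMulLog, neg_mul, neg_neg, hM' c, Finset.sum_mul]
    refine Finset.sum_congr rfl fun b hb => ?_
    rw [← Finset.sum_mul, hM, (Finset.mem_filter.1 hb).2, hM' c]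
  have e4 : ∑ a, ∑ b, P' a (φ b) * (M b / M' (φ b)) ≤ ∑ a, ∑ b, P a b := by
    rw [Finset.sum_comm, Finset.sum_comm (f := P)]
    refine Finset.sum_le_sum fun b _ => ?_
    rw [← Finset.sum_mul, hPM', hM]
    rcases ((hM0 b).trans (hMM b)).eq_or_lt with h | h
    · rw [← h, zero_mul]
      exact hM0 b
    · rw [mul_div_cancel₀ _ h.ne']
  rw [e1, e2, e3] at hsum
  linarith

/-- Some colouring `ρ : Z → Fin k` has a small collision probability. -/
theorem exists_colouring_collision_le {Z ι β ν : Type*} [Fintype Z] [DecidableEq Z] [Fintype ι]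
    [DecidableEq ι] [Fintype β] [Fintype ν] [DecidableEq ν] {k m : ℕ} (hk : 0 < k) (e : Fin m → ι)
    {P G : (ι → Z) → β → ℝ} {M : β → ℝ} (hG0 : ∀ u b, 0 ≤ G u b) (hGP : ∀ u b, G u b ≤ P u b)
    (hM : ∀ b, ∑ u, P u b = M b) (hM1 : ∑ b, M b ≤ 1) (N : (ι → Z) → ν)
    (hinj : ∀ u b, G u b ≠ 0 → Function.Injective (u ∘ e))
    (hN : ∀ u u' b, G u b ≠ 0 → P u' b ≠ 0 → (∃ t, u (e t) = u' (e t)) → N u = N u')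
    {q : ℝ} (hq0 : 0 ≤ q) (hq : ∀ A b, ∑ u with N u = A, G u b ≤ q * M b) {s : ℝ} (hs0 : 0 ≤ s)
    (hs : 1 ≤ s ^ 2 * k ^ m) :
    ∃ ρ : Z → Fin k, ∑ b, ∑ u, ∑ u', (if ρ ∘ u = ρ ∘ u' then G u b * P u' b / M b else 0) ≤
      q + s := by
  classical
  have hP0 : ∀ u b, 0 ≤ P u b := fun u b => (hG0 u b).trans (hGP u b)
  have hM0 : ∀ b, 0 ≤ M b := fun b => hM b ▸ Finset.sum_nonneg fun a _ => hP0 a b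
  have hW0 : ∀ u u' b, 0 ≤ G u b * P u' b / M b := fun u u' b =>
    div_nonneg (mul_nonneg (hG0 u b) (hP0 u' b)) (hM0 b)
  set K : ℝ := (k : ℝ) ^ Fintype.card Z with hK
  have hcard : ((Finset.univ : Finset (Z → Fin k)).card : ℝ) = K := by simp [hK]
  have hKpos : 0 < K := by positivity
  have hne : Nonempty (Z → Fin k) := ⟨fun _ => ⟨0, hk⟩⟩
  -- First moment over a uniform `ρ`. A pair with equal `N` is counted as always colliding; by `hN`,
  -- any other pair differs at every position `e t` and collides with probability at most `s`.
  have count : ∀ u u' b, ∑ ρ : Z → Fin k, (if ρ ∘ u = ρ ∘ u' then G u b * P u' b / M b else 0) ≤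
      K * ((if N u = N u' then G u b * P u' b / M b else 0) + s * (G u b * P u' b / M b)) := by
    intro u u' b
    by_cases hW : G u b * P u' b / M b = 0
    · simp [hW]
    have hGu : G u b ≠ 0 := fun h => hW (by simp [h])
    have hPu : P u' b ≠ 0 := fun h => hW (by simp [h])
    rw [← Finset.sum_filter, Finset.sum_const, nsmul_eq_mul]
    by_cases hu : ∃ t, u (e t) = u' (e t)
    · rw [if_pos (hN u u' b hGu hPu hu)]
      have h1 : ((Finset.univ.filter fun ρ : Z → Fin k => ρ ∘ u = ρ ∘ u').card : ℝ) ≤ K := by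
        rw [← hcard]
        exact_mod_cast Finset.card_le_univ _
      calc _ ≤ K * (G u b * P u' b / M b) := mul_le_mul_of_nonneg_right h1 (hW0 u u' b)
        _ ≤ _ := by
          refine mul_le_mul_of_nonneg_left ?_ hKpos.le
          linarith [mul_nonneg hs0 (hW0 u u' b)]
    · push Not at hu
      have h1 := card_colouring_sq_mul_le hk (u ∘ e) (u' ∘ e) (hinj u b hGu) hu
      set c : ℕ := (Finset.univ.filter fun ρ : Z → Fin k =>
        ∀ t, ρ ((u ∘ e) t) = ρ ((u' ∘ e) t)).card with hc
      have h2 : ((Finset.univ.filter fun ρ : Z → Fin k => ρ ∘ u = ρ ∘ u').card : ℝ) ≤ c := by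
        rw [hc]
        exact_mod_cast Finset.card_le_card fun ρ hρ => by
          simp only [Finset.mem_filter, Finset.mem_univ, true_and] at hρ ⊢
          exact fun t => congrFun hρ (e t)
      have h3 : (c : ℝ) ^ 2 * k ^ m ≤ K ^ 2 := by
        rw [hK]
        exact_mod_cast h1
      have h4 : (c : ℝ) ≤ K * s := by
        refine le_of_sq_le_sq ?_ (by positivity)
        calc (c : ℝ) ^ 2 = c ^ 2 * 1 := by ring
          _ ≤ c ^ 2 * (s ^ 2 * k ^ m) := by gcongr
          _ = (c ^ 2 * k ^ m) * s ^ 2 := by ring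
          _ ≤ K ^ 2 * s ^ 2 := by gcongr
          _ = _ := by ring
      calc _ ≤ K * s * (G u b * P u' b / M b) := mul_le_mul_of_nonneg_right (h2.trans h4) (hW0 u u' b)
        _ = K * (0 + s * (G u b * P u' b / M b)) := by ring
        _ ≤ _ := by
          refine mul_le_mul_of_nonneg_left ?_ hKpos.le
          gcongr
          split_ifs
          · exact hW0 u u' b
          · exact le_rfl
  -- For fixed `u'` and `b`, the words `u` with `N u = N u'` have total `G`-weight at most `q * M
  -- b`.
  have bound1 : ∑ b, ∑ u, ∑ u', (if N u = N u' then G u b * P u' b / M b else 0) ≤ q := by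
    calc _ ≤ ∑ b, q * M b := Finset.sum_le_sum fun b _ => ?_
      _ ≤ q := by
        rw [← Finset.mul_sum]
        exact mul_le_of_le_one_right hq0 hM1
    rw [Finset.sum_comm]
    calc _ ≤ ∑ u', q * P u' b := Finset.sum_le_sum fun u' _ => ?_
      _ = q * M b := by rw [← Finset.mul_sum, hM]
    rw [← Finset.sum_filter]
    have : ∑ u with N u = N u', G u b * P u' b / M b = (∑ u with N u = N u', G u b) * P u' b / M b := by
      rw [Finset.sum_mul, Finset.sum_div]
    rw [this]
    rcases (hM0 b).eq_or_lt with h | h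
    · rw [← h, div_zero]
      exact mul_nonneg hq0 (hP0 u' b)
    · rw [div_le_iff₀ h]
      calc _ ≤ q * M b * P u' b := mul_le_mul_of_nonneg_right (hq _ b) (hP0 u' b)
        _ = _ := by ring
  have bound2 : ∑ b, ∑ u, ∑ u', G u b * P u' b / M b ≤ 1 := by
    calc _ ≤ ∑ b, M b := Finset.sum_le_sum fun b _ => ?_
      _ ≤ 1 := hM1
    rcases (hM0 b).eq_or_lt with h | h
    · simp [← h]
    · have : ∑ u, ∑ u', G u b * P u' b / M b = ∑ u, G u b := by
        refine Finset.sum_congr rfl fun u _ => ?_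
        rw [← Finset.sum_div, ← Finset.mul_sum, hM, mul_div_cancel_right₀ _ h.ne']
      rw [this, ← hM b]
      exact Finset.sum_le_sum fun u _ => hGP u b
  by_contra! hcon
  have h1 : K * (q + s) < ∑ ρ : Z → Fin k, ∑ b, ∑ u, ∑ u',
      (if ρ ∘ u = ρ ∘ u' then G u b * P u' b / M b else 0) := by
    rw [← hcard, ← nsmul_eq_mul, ← Finset.sum_const]
    exact Finset.sum_lt_sum_of_nonempty Finset.univ_nonempty fun ρ _ => hcon ρ
  have h2 : ∑ ρ : Z → Fin k, ∑ b, ∑ u, ∑ u',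
      (if ρ ∘ u = ρ ∘ u' then G u b * P u' b / M b else 0) ≤ K * (q + s) := by
    calc _ = ∑ b, ∑ u, ∑ u', ∑ ρ : Z → Fin k,
        (if ρ ∘ u = ρ ∘ u' then G u b * P u' b / M b else 0) := by
          rw [Finset.sum_comm]
          refine Finset.sum_congr rfl fun b _ => ?_
          rw [Finset.sum_comm]
          refine Finset.sum_congr rfl fun u _ => ?_
          rw [Finset.sum_comm]
      _ ≤ ∑ b, ∑ u, ∑ u', K * ((if N u = N u' then G u b * P u' b / M b else 0) +
            s * (G u b * P u' b / M b)) :=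
          Finset.sum_le_sum fun b _ => Finset.sum_le_sum fun u _ => Finset.sum_le_sum fun u' _ =>
            count u u' b
      _ = K * (∑ b, ∑ u, ∑ u', (if N u = N u' then G u b * P u' b / M b else 0) +
            s * ∑ b, ∑ u, ∑ u', G u b * P u' b / M b) := by
          simp only [Finset.mul_sum, Finset.sum_add_distrib, mul_add]
      _ ≤ _ := by
          refine mul_le_mul_of_nonneg_left ?_ hKpos.le
          exact add_le_add bound1 (mul_le_of_le_one_right hs0 bound2)
  exact absurd h1 (not_lt.2 h2)

/-! ### Conditional entropy of finite measurable partitions -/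

section Fibres

variable {Ω : Type*} [MeasurableSpace Ω]

theorem measureReal_inter_comp_fibre {α γ : Type*} [Fintype α] [MeasurableSpace α]
    [MeasurableSingletonClass α] [DecidableEq γ] (μ : Measure Ω) [IsFiniteMeasure μ] {ξ : Ω → α}
    (hξ : Measurable ξ) (φ : α → γ) (c : γ) {S : Set Ω} (hS : MeasurableSet S) :
    μ.real (((φ ∘ ξ) ⁻¹' {c}) ∩ S) = ∑ a with φ a = c, μ.real (ξ ⁻¹' {a} ∩ S) := by
  rw [← measureReal_biUnion_finset]
  · congr 1
    ext x
    simp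
  · intro a _ b _ hab
    refine Set.disjoint_left.2 fun x hx hy => hab ?_
    exact (Set.mem_singleton_iff.1 hx.1).symm.trans (Set.mem_singleton_iff.1 hy.1)
  · exact fun a _ => (hξ (measurableSet_singleton a)).inter hS

theorem sum_measureReal_fibre_inter {α : Type*} [Fintype α] [MeasurableSpace α]
    [MeasurableSingletonClass α] (μ : Measure Ω) [IsFiniteMeasure μ] {ξ : Ω → α}
    (hξ : Measurable ξ) {S : Set Ω} (hS : MeasurableSet S) :
    ∑ a, μ.real (ξ ⁻¹' {a} ∩ S) = μ.real S := by
  have := measureReal_inter_comp_fibre μ hξ (fun _ => ()) () hS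
  simp only [Finset.filter_true] at this
  rw [← this]
  congr 1
  ext x
  simp

theorem partitionEntropy_prodMk {α β : Type*} [Fintype α] [Fintype β] (μ : Measure Ω)
    (ξ : Ω → α) (η : Ω → β) : partitionEntropy μ (fun x => (ξ x, η x)) =
      ∑ a, ∑ b, Real.negMulLog (μ.real (ξ ⁻¹' {a} ∩ η ⁻¹' {b})) := by
  unfold partitionEntropy
  rw [Fintype.sum_prod_type]
  refine Finset.sum_congr rfl fun a _ => Finset.sum_congr rfl fun b _ => ?_
  congr 2
  ext x
  simp

/-- Conditional entropy increases when the condition becomes coarser. -/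
theorem partitionEntropy_prod_sub_le_comp {α β γ : Type*} [Fintype α] [Fintype β] [Fintype γ]
    [MeasurableSpace α] [MeasurableSpace β] [MeasurableSingletonClass α]
    [MeasurableSingletonClass β] (μ : Measure Ω) [IsFiniteMeasure μ]
    {ξ : Ω → α} {η : Ω → β} (hξ : Measurable ξ) (hη : Measurable η) (φ : β → γ) :
    partitionEntropy μ (fun x => (ξ x, η x)) - partitionEntropy μ η ≤
      partitionEntropy μ (fun x => (ξ x, (φ ∘ η) x)) - partitionEntropy μ (φ ∘ η) := by
  classical
  rw [partitionEntropy_prodMk, partitionEntropy_prodMk]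
  refine condEntropy_le_condEntropy_comp (fun _ _ => measureReal_nonneg)
    (fun b => sum_measureReal_fibre_inter μ hξ (hη (measurableSet_singleton b))) φ ?_ ?_
  · intro a c
    rw [Set.inter_comm, measureReal_inter_comp_fibre μ hη φ c (hξ (measurableSet_singleton a))]
    simp only [Set.inter_comm]
  · intro c
    have := measureReal_inter_comp_fibre μ hη φ c MeasurableSet.univ
    simpa using this

end Fibres

/-! ### Random colourings of a fine partition -/

section Hash

variable {Ω : Type*} [MeasurableSpace Ω]

theorem measurable_itinerary_of_countable {α : Type*} [MeasurableSpace α] {T : Ω → Ω} {ξ : Ω → α}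
    (hT : Measurable T) (hξ : Measurable ξ) (n : ℕ) : Measurable (itinerary T ξ n) :=
  measurable_pi_lambda _ fun j => hξ.comp (hT.iterate j)

/-- A colouring of the atoms of the fine partition `ζ` whose itineraries of length `2 * m` have large
entropy relative to the future itinerary of `ζ`. -/
theorem exists_colouring_condEntropy_ge {T : Ω → Ω} {μ : Measure Ω} [IsProbabilityMeasure μ]
    (hT : MeasurePreserving T μ μ) {k m l l' : ℕ} (hk : 0 < k) {Q : Ω → Fin l} (hQ : Measurable Q)
    {θ : Ω → Fin l'} (hθ : Measurable θ) {g : Measure Ω} (hg : g ≤ μ) {q : ℝ} (hq0 : 0 ≤ q)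
    (hq : ∀ (A : Fin m → Fin l) (D : Set Ω), MeasurableSet D →
      g.real (T^[m] ⁻¹' (itinerary T Q m ⁻¹' {A}) ∩ T^[2 * m] ⁻¹' D) ≤ q * μ.real D)
    (hd : g {x | ¬ Function.Injective (itinerary T θ m x)} = 0) {s : ℝ} (hs0 : 0 < s)
    (hs : 1 ≤ s ^ 2 * k ^ m) (n : ℕ) :
    ∃ ρ : ((Fin (2 * m) → Fin l) × Fin l') → Fin k,
      g.real Set.univ * (1 - Real.log (q + s)) - 1 ≤
      partitionEntropy μ (fun x =>
        (itinerary T (ρ ∘ fun x => (itinerary T Q (2 * m) x, θ x)) (2 * m) x,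
          (itinerary T (fun x => (itinerary T Q (2 * m) x, θ x)) n ∘ T^[2 * m]) x)) -
      partitionEntropy μ
        (itinerary T (fun x => (itinerary T Q (2 * m) x, θ x)) n ∘ T^[2 * m]) := by
  classical
  have hgf : IsFiniteMeasure g := isFiniteMeasure_of_le μ hg
  set ζ : Ω → (Fin (2 * m) → Fin l) × Fin l' := fun x => (itinerary T Q (2 * m) x, θ x) with hζ
  have hTm := hT.measurable
  have hζm : Measurable ζ := (measurable_itinerary_of_countable hTm hQ _).prodMk hθ
  set Θ := itinerary T ζ (2 * m) with hΘ
  have hΘm : Measurable Θ := measurable_itinerary_of_countable hTm hζm _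
  set η := itinerary T ζ n with hη
  have hηm : Measurable η := measurable_itinerary_of_countable hTm hζm _
  have hβm : Measurable (η ∘ T^[2 * m]) := hηm.comp (hTm.iterate _)
  have hb : ∀ b, MeasurableSet ((η ∘ T^[2 * m]) ⁻¹' {b}) := fun b =>
    hβm (measurableSet_singleton b)
  let P : (Fin (2 * m) → (Fin (2 * m) → Fin l) × Fin l') →
      (Fin n → (Fin (2 * m) → Fin l) × Fin l') → ℝ :=
    fun u b => μ.real (Θ ⁻¹' {u} ∩ (η ∘ T^[2 * m]) ⁻¹' {b})
  let G : (Fin (2 * m) → (Fin (2 * m) → Fin l) × Fin l') →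
      (Fin n → (Fin (2 * m) → Fin l) × Fin l') → ℝ :=
    fun u b => g.real (Θ ⁻¹' {u} ∩ (η ∘ T^[2 * m]) ⁻¹' {b})
  let M : (Fin n → (Fin (2 * m) → Fin l) × Fin l') → ℝ :=
    fun b => μ.real ((η ∘ T^[2 * m]) ⁻¹' {b})
  have hPM : ∀ b, ∑ u, P u b = M b := fun b => sum_measureReal_fibre_inter μ hΘm (hb b)
  have hGP : ∀ u b, G u b ≤ P u b := fun u b =>
    ENNReal.toReal_mono (measure_ne_top _ _) (hg _)
  have hM1 : ∑ b, M b ≤ 1 := by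
    have := sum_measureReal_fibre_inter μ hβm MeasurableSet.univ
    simp only [Set.inter_univ, probReal_univ] at this
    exact this.le
  let e : Fin m → Fin (2 * m) := fun t => ⟨t, by omega⟩
  -- `N` reads the `Q`-names at times `m, …, 2 * m - 1` off the label at time `m`. This is the time
  -- window in which `hq` provides the spread.
  let N : (Fin (2 * m) → (Fin (2 * m) → Fin l) × Fin l') → (Fin m → Fin l) :=
    fun u i => (u ⟨m, by have := i.2; omega⟩).1 ⟨i, by omega⟩
  have hNΘ : N ∘ Θ = itinerary T Q m ∘ T^[m] := by
    ext x i
    simp [N, Θ, ζ, itinerary]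
  have hne : ∀ {ν : Measure Ω} {S : Set Ω}, ν.real S ≠ 0 → S.Nonempty := by
    intro ν S h
    by_contra hS
    rw [Set.not_nonempty_iff_eq_empty] at hS
    exact h (by simp [hS])
  have hinj : ∀ u b, G u b ≠ 0 → Function.Injective (u ∘ e) := by
    intro u b h
    by_contra hcon
    refine h ?_
    have hsub : Θ ⁻¹' {u} ∩ (η ∘ T^[2 * m]) ⁻¹' {b} ⊆
        {x | ¬ Function.Injective (itinerary T θ m x)} := by
      rintro x ⟨hx, -⟩ hx'
      apply hcon
      intro t t' htt
      apply hx'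
      have hx : Θ x = u := hx
      have h1 := congrArg Prod.snd htt
      simpa [← hx, Θ, ζ, e, itinerary] using h1
    have : g (Θ ⁻¹' {u} ∩ (η ∘ T^[2 * m]) ⁻¹' {b}) = 0 := measure_mono_null hsub hd
    simp [G, measureReal_def, this]
  have hN : ∀ u u' b, G u b ≠ 0 → P u' b ≠ 0 → (∃ t, u (e t) = u' (e t)) → N u = N u' := by
    rintro u u' b hu hu' ⟨t, ht⟩
    obtain ⟨x, hx, -⟩ := hne hu
    obtain ⟨x', hx', -⟩ := hne hu'
    have hx : Θ x = u := hx
    have hx' : Θ x' = u' := hx'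
    have h1 : (N ∘ Θ) x = (N ∘ Θ) x' := by
      rw [hNΘ]
      ext i
      have h2 := congrArg Prod.fst ht
      rw [← hx, ← hx'] at h2
      -- A label at time `t < m` records the `Q`-names at times `t, …, t + 2 * m - 1`, which include
      -- the whole window `m, …, 2 * m - 1`. This is why labels have length `2 * m`: words that
      -- agree at one time `t < m` have the same `N`.
      have h3 := congrFun h2 ⟨m + i - t, by have := t.2; have := i.2; omega⟩
      have h4 : m + (i : ℕ) - t + t = i + m := by have := t.2; omega
      simp only [Θ, ζ, itinerary, e, ← Function.iterate_add_apply, h4] at h3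
      simp only [itinerary, Function.comp_apply, ← Function.iterate_add_apply, h3]
    simpa [hx, hx'] using h1
  have hq' : ∀ A b, ∑ u with N u = A, G u b ≤ q * M b := by
    intro A b
    have h1 := measureReal_inter_comp_fibre g hΘm N A (hb b)
    rw [hNΘ] at h1
    have h2 : M b = μ.real (η ⁻¹' {b}) := by
      simp only [M, Set.preimage_comp]
      exact (hT.iterate _).measureReal_preimage (hηm (measurableSet_singleton b)).nullMeasurableSet
    rw [← h1, h2]
    have := hq A (η ⁻¹' {b}) (hηm (measurableSet_singleton b))
    simpa only [Set.preimage_comp] using this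
  obtain ⟨ρ, hρ⟩ := exists_colouring_collision_le hk e (fun u b => measureReal_nonneg) hGP hPM hM1 N
    hinj hN hq0 hq' hs0.le hs
  refine ⟨ρ, ?_⟩
  have hα : itinerary T (ρ ∘ ζ) (2 * m) = (fun u => ρ ∘ u) ∘ Θ := by
    ext x i
    simp [itinerary, Θ]
  rw [partitionEntropy_prodMk, hα]
  have hPa : ∀ a b, μ.real (((fun u => ρ ∘ u) ∘ Θ) ⁻¹' {a} ∩ (η ∘ T^[2 * m]) ⁻¹' {b}) =
      ∑ u with ρ ∘ u = a, P u b := fun a b => measureReal_inter_comp_fibre μ hΘm _ a (hb b)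
  have hMeq : partitionEntropy μ (η ∘ T^[2 * m]) = ∑ b, Real.negMulLog (M b) := rfl
  simp only [hPa, hMeq]
  have hGsum : ∑ a : Fin (2 * m) → Fin k, ∑ b, ∑ u with ρ ∘ u = a, G u b = g.real Set.univ := by
    rw [Finset.sum_comm]
    have h1 := sum_measureReal_fibre_inter g hβm MeasurableSet.univ
    simp only [Set.inter_univ] at h1
    rw [← h1]
    refine Finset.sum_congr rfl fun b _ => ?_
    rw [Finset.sum_fiberwise, ← sum_measureReal_fibre_inter g hΘm (hb b)]
  rw [← hGsum]
  refine le_condEntropy_of_collision (fun a b => Finset.sum_nonneg fun u _ => measureReal_nonneg)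
    (fun a b => Finset.sum_le_sum fun u _ => hGP u b) (fun b => ?_) (by positivity) ?_
  · rw [Finset.sum_fiberwise, hPM]
  · refine le_of_eq_of_le ?_ hρ
    rw [Finset.sum_comm]
    refine Finset.sum_congr rfl fun b _ => ?_
    rw [← Finset.sum_fiberwise (s := Finset.univ) (g := fun u => ρ ∘ u)]
    refine Finset.sum_congr rfl fun a _ => ?_
    rw [Finset.sum_mul_sum, Finset.sum_div]
    refine Finset.sum_congr rfl fun u hu => ?_
    rw [Finset.sum_div, Finset.sum_filter]
    refine Finset.sum_congr rfl fun u' _ => ?_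
    rw [(Finset.mem_filter.1 hu).2]
    simp only [eq_comm]

end Hash

/-! ### Positive Kolmogorov-Sinai mean dimension from spread fibres -/

/-- For every rate `R`, the orbit segments of some length `m`, up to a finite partition `Q`, have
conditional probability at most `exp (-R * m)` given the orbit after time `m`, on a part `g` of `μ`
of mass arbitrarily close to `1`. -/
def HasSpreadFibres {Ω : Type*} [MeasurableSpace Ω] (T : Ω → Ω) (μ : Measure Ω) : Prop :=
  ∀ R η : ℝ, 0 < η → ∃ m : ℕ, 1 ≤ m ∧ ∃ g : Measure Ω, g ≤ μ ∧ 1 - η ≤ g.real Set.univ ∧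
    ∃ (l : ℕ) (Q : Ω → Fin l), Measurable Q ∧ ∀ (A : Fin m → Fin l) (D : Set Ω), MeasurableSet D →
      g.real (itinerary T Q m ⁻¹' {A} ∩ T^[m] ⁻¹' D) ≤ Real.exp (-(R * m)) * μ.real D

/-- The density of `g` with respect to `μ`, composed with `S`, is the density of the required
measure. This moves the spread of the fibres to a later time window. -/
theorem exists_measure_le_map_eq {Ω : Type*} [MeasurableSpace Ω] {μ : Measure Ω} [IsFiniteMeasure μ]
    {S : Ω → Ω} (hS : MeasurePreserving S μ μ) {g : Measure Ω} (hg : g ≤ μ) :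
    ∃ g' : Measure Ω, g' ≤ μ ∧ g'.map S = g := by
  have : IsFiniteMeasure g := isFiniteMeasure_of_le μ hg
  have hac : g ≪ μ := Measure.absolutelyContinuous_of_le hg
  have hγ : Measurable (g.rnDeriv μ) := Measure.measurable_rnDeriv g μ
  refine ⟨μ.withDensity (g.rnDeriv μ ∘ S), ?_, ?_⟩
  · have h1 : g.rnDeriv μ ∘ S ≤ᵐ[μ] 1 :=
      hS.quasiMeasurePreserving.ae (Measure.rnDeriv_le_one_of_le hg)
    calc _ ≤ μ.withDensity 1 := withDensity_mono h1
      _ = μ := withDensity_one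
  · ext E hE
    rw [Measure.map_apply hS.measurable hE, withDensity_apply _ (hS.measurable hE)]
    calc _ = ∫⁻ x in E, g.rnDeriv μ x ∂μ := hS.setLIntegral_comp_preimage hE hγ
      _ = μ.withDensity (g.rnDeriv μ) E := (withDensity_apply _ hE).symm
      _ = g E := by rw [Measure.withDensity_rnDeriv_eq g μ hac]

/-- A finite measurable partition of the unit interval into small pieces. -/
theorem exists_fine_labelling {ε : ℝ} (hε : 0 < ε) :
    ∃ (l : ℕ) (θ : I → Fin l), Measurable θ ∧ ∀ x y, θ x = θ y → dist x y < ε := by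
  obtain ⟨n, hn⟩ := exists_nat_one_div_lt hε
  have hn0 : (0 : ℝ) < (n : ℝ) + 1 := by positivity
  have hb : ∀ x : I, ⌊((n : ℝ) + 1) * x⌋₊ < n + 2 := fun x => by
    rw [Nat.floor_lt (mul_nonneg hn0.le x.2.1)]
    push_cast
    nlinarith [x.2.2]
  refine ⟨n + 2, fun x => ⟨⌊((n : ℝ) + 1) * x⌋₊, hb x⟩, ?_, fun x y h => ?_⟩
  · refine measurable_to_countable' fun j => ?_
    have hm : Measurable fun x : I => ⌊((n : ℝ) + 1) * x⌋₊ :=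
      Nat.measurable_floor.comp (measurable_subtype_coe.const_mul _)
    convert hm (measurableSet_singleton (j : ℕ)) using 1
    ext x
    simp [Fin.ext_iff]
  · have h1 : ⌊((n : ℝ) + 1) * x⌋₊ = ⌊((n : ℝ) + 1) * y⌋₊ := congrArg Fin.val h
    have a1 := Nat.floor_le (mul_nonneg hn0.le x.2.1)
    have a2 := Nat.lt_floor_add_one (((n : ℝ) + 1) * x)
    have b1 := Nat.floor_le (mul_nonneg hn0.le y.2.1)
    have b2 := Nat.lt_floor_add_one (((n : ℝ) + 1) * y)
    rw [h1] at a1 a2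
    refine lt_trans ?_ hn
    rw [Subtype.dist_eq, Real.dist_eq, lt_div_iff₀ hn0, ← abs_of_pos hn0, ← abs_mul, abs_lt]
    constructor <;> nlinarith

section SpreadFibres

variable {T : I → I} {μ : Measure I}

/-- On periodic points the future determines the past, which contradicts the spread of the fibres
unless such points form a null set. -/
theorem HasSpreadFibres.measure_fixedPoints_iterate [IsProbabilityMeasure μ]
    (hT : MeasurePreserving T μ μ) (h : HasSpreadFibres T μ) {p : ℕ} (hp : 0 < p) :
    μ {x | T^[p] x = x} = 0 := by
  have hTm := hT.measurable
  set F := {x | T^[p] x = x} with hF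
  have hFm : MeasurableSet F := measurableSet_eq_fun (hTm.iterate p) measurable_id
  have key : ∀ R η : ℝ, 0 < R → 0 < η → μ.real F ≤ Real.exp (-R) + η := by
    intro R η hR hη
    obtain ⟨m, hm, g, hg, hg1, l, Q, hQ, hb⟩ := h R η hη
    have : IsFiniteMeasure g := isFiniteMeasure_of_le μ hg
    have hgr : ∀ S, g.real S ≤ μ.real S := fun S => ENNReal.toReal_mono (measure_ne_top _ _) (hg S)
    have hi := measurable_itinerary hTm hQ m
    have hD : ∀ A, MeasurableSet (T^[(p - 1) * m] ⁻¹' (itinerary T Q m ⁻¹' {A})) := fun A =>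
      hTm.iterate _ (hi (measurableSet_singleton A))
    -- For `x` in `F`, the point `T^[m] x` returns to `x` after `(p - 1) * m` further steps. The
    -- itinerary `A` of `x` thus forces `T^[m] x` into a set `D` depending on `A`, and these sets
    -- partition `F`.
    have h1 : g.real F ≤ Real.exp (-(R * m)) := by
      rw [← sum_measureReal_fibre_inter g hi hFm]
      calc _ ≤ ∑ A, Real.exp (-(R * m)) *
            μ.real (T^[(p - 1) * m] ⁻¹' (itinerary T Q m ⁻¹' {A}) ∩ F) := by
            refine Finset.sum_le_sum fun A _ => le_trans (measureReal_mono ?_) (hb A _ ((hD A).inter hFm))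
            rintro x ⟨hx, hxF⟩
            have hxF : T^[p] x = x := hxF
            refine ⟨hx, ?_, ?_⟩
            · have : T^[(p - 1) * m] (T^[m] x) = x := by
                rw [← Function.iterate_add_apply]
                have : (p - 1) * m + m = p * m := by
                  obtain ⟨p, rfl⟩ := Nat.exists_eq_add_of_lt hp
                  simp
                  ring
                rw [this, Function.iterate_mul]
                exact Function.iterate_fixed hxF m
              simpa [Set.mem_preimage, this] using hx
            · show T^[p] (T^[m] x) = T^[m] x
              rw [← Function.iterate_add_apply, Nat.add_comm, Function.iterate_add_apply, hxF]
        _ = Real.exp (-(R * m)) * μ.real F := by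
            rw [← Finset.mul_sum]
            congr 1
            exact sum_measureReal_fibre_inter μ (hi.comp (hTm.iterate _)) hFm
        _ ≤ _ := mul_le_of_le_one_right (Real.exp_nonneg _) measureReal_le_one
    have h2 : μ.real F - g.real F ≤ η := by
      have a1 := measureReal_add_measureReal_compl (μ := μ) hFm
      have a2 := measureReal_add_measureReal_compl (μ := g) hFm
      have a3 := hgr Fᶜ
      rw [probReal_univ] at a1
      linarith
    have h3 : Real.exp (-(R * m)) ≤ Real.exp (-R) := by
      refine Real.exp_le_exp.2 (neg_le_neg ?_)
      exact le_mul_of_one_le_right hR.le (by exact_mod_cast hm)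
    linarith
  have hle : μ.real F ≤ 0 := by
    refine le_of_forall_pos_le_add fun ε hε => ?_
    have hε2 : 0 < ε / 2 := by positivity
    have h1 := key (max 1 (-Real.log (ε / 2))) (ε / 2) (by positivity) hε2
    have h2 : Real.exp (-(max 1 (-Real.log (ε / 2)))) ≤ ε / 2 := by
      calc _ ≤ Real.exp (Real.log (ε / 2)) :=
            Real.exp_le_exp.2 (by linarith [le_max_right 1 (-Real.log (ε / 2))])
        _ = _ := Real.exp_log hε2
    linarith
  exact (measureReal_eq_zero_iff).1 (le_antisymm hle measureReal_nonneg)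

/-- A fine finite partition separates the points of most orbit segments. -/
theorem HasSpreadFibres.exists_separating_labelling [IsProbabilityMeasure μ]
    (hT : MeasurePreserving T μ μ) (h : HasSpreadFibres T μ) (m : ℕ) {ε : ℝ} (hε : 0 < ε) :
    ∃ (l : ℕ) (θ : I → Fin l), Measurable θ ∧
      μ.real {x | ¬ Function.Injective (itinerary T θ m x)} < ε := by
  have hTm := hT.measurable
  let E : ℕ → Set I := fun n => ⋃ s : Fin m, ⋃ t : Fin m, ⋃ _ : s < t,
    {x | dist (T^[s] x) (T^[t] x) ≤ 1 / ((n : ℝ) + 1)}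
  have hE : ∀ n, MeasurableSet (E n) := fun n =>
    MeasurableSet.iUnion fun s => MeasurableSet.iUnion fun t => MeasurableSet.iUnion fun _ =>
      measurableSet_le ((hTm.iterate s).dist (hTm.iterate t)) measurable_const
  have hanti : Antitone E := by
    intro a b hab x hx
    simp only [E, Set.mem_iUnion, Set.mem_ofPred_eq] at hx ⊢
    obtain ⟨s, t, hst, hx⟩ := hx
    refine ⟨s, t, hst, hx.trans ?_⟩
    gcongr
  have hinter : μ (⋂ n, E n) = 0 := by
    -- If two of the first `m` orbit points are arbitrarily close, they coincide, so the orbit has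
    -- entered a cycle. By invariance and the nullity of periodic points this has measure zero.
    have hsub : ⋂ n, E n ⊆ ⋃ s : Fin m, ⋃ t : Fin m, ⋃ _ : s < t,
        T^[s] ⁻¹' {x | T^[(t : ℕ) - s] x = x} := by
      intro x hx
      by_contra hcon
      simp only [Set.mem_iUnion, not_exists, Set.mem_preimage, Set.mem_ofPred_eq,
        ← Function.iterate_add_apply] at hcon
      have hev : ∀ᶠ n : ℕ in atTop, ∀ s t : Fin m, s < t →
          1 / ((n : ℝ) + 1) < dist (T^[s] x) (T^[t] x) := by
        refine eventually_all.2 fun s => eventually_all.2 fun t => ?_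
        by_cases hst : s < t
        · have hpos : 0 < dist (T^[s] x) (T^[t] x) := by
            rw [dist_pos]
            intro heq
            refine hcon s t hst ?_
            rw [Nat.sub_add_cancel (by exact_mod_cast hst.le), heq]
          filter_upwards [tendsto_one_div_add_atTop_nhds_zero_nat.eventually (gt_mem_nhds hpos)] with
            n hn _ using hn
        · exact Eventually.of_forall fun n h => absurd h hst
      obtain ⟨n, hn⟩ := hev.exists
      have := Set.mem_iInter.1 hx n
      simp only [E, Set.mem_iUnion, Set.mem_ofPred_eq] at this
      obtain ⟨s, t, hst, hx⟩ := this
      linarith [hn s t hst]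
    refine measure_mono_null hsub ?_
    simp only [measure_iUnion_null_iff]
    intro s t hst
    have hF : MeasurableSet {x | T^[(t : ℕ) - s] x = x} :=
      measurableSet_eq_fun (hTm.iterate _) measurable_id
    rw [(hT.iterate s).measure_preimage hF.nullMeasurableSet]
    exact h.measure_fixedPoints_iterate hT (by have : (s : ℕ) < t := hst; omega)
  have hlim := tendsto_measure_iInter_atTop (μ := μ) (fun n => (hE n).nullMeasurableSet) hanti
    ⟨0, measure_ne_top _ _⟩
  rw [hinter] at hlim
  obtain ⟨n, hn⟩ := (hlim.eventually (gt_mem_nhds (ENNReal.ofReal_pos.2 hε))).exists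
  obtain ⟨l, θ, hθ, hsep⟩ := exists_fine_labelling (ε := 1 / ((n : ℝ) + 1)) (by positivity)
  refine ⟨l, θ, hθ, ?_⟩
  have hsub : {x | ¬ Function.Injective (itinerary T θ m x)} ⊆ E n := by
    intro x hx
    simp only [Function.Injective, Set.mem_ofPred_eq, not_forall] at hx
    obtain ⟨s, t, heq, hne⟩ := hx
    simp only [E, Set.mem_iUnion, Set.mem_ofPred_eq]
    have hd := (hsep _ _ heq).le
    rcases lt_or_gt_of_ne hne with hst | hst
    · exact ⟨s, t, hst, hd⟩
    · exact ⟨t, s, hst, by rwa [dist_comm]⟩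
  calc _ ≤ μ.real (E n) := measureReal_mono hsub
    _ < ε := by
      rw [measureReal_def]
      exact (ENNReal.toReal_lt_of_lt_ofReal hn)

/-- Chain rule: prefixing a block of length `N` adds its entropy conditional on the later colours,
which is at least its entropy conditional on the finer `ζ`-itinerary, hence at least `c`. The
itinerary must have length `n ≥ r * N` to determine those colours; bounds for arbitrarily large `n`
suffice. -/
theorem partitionEntropy_itinerary_mul_ge {Ω Z : Type*} [MeasurableSpace Ω] [Fintype Z]
    [MeasurableSpace Z] [MeasurableSingletonClass Z] {T : Ω → Ω} {μ : Measure Ω}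
    [IsProbabilityMeasure μ] (hT : MeasurePreserving T μ μ) {ζ : Ω → Z} (hζ : Measurable ζ) {k N : ℕ}
    (ρ : Z → Fin k) {c : ℝ}
    (h : ∀ n₀, ∃ n ≥ n₀, c ≤ partitionEntropy μ (fun x => (itinerary T (ρ ∘ ζ) N x,
      (itinerary T ζ n ∘ T^[N]) x)) - partitionEntropy μ (itinerary T ζ n ∘ T^[N])) (r : ℕ) :
    r * c ≤ partitionEntropy μ (itinerary T (ρ ∘ ζ) (r * N)) := by
  have hTm := hT.measurable
  have hξ : Measurable (ρ ∘ ζ) := (measurable_of_finite ρ).comp hζ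
  induction r with
  | zero => simpa using partitionEntropy_nonneg μ _
  | succ r ih =>
    obtain ⟨n, hn, hc⟩ := h (r * N)
    have hηm : Measurable (itinerary T ζ n ∘ T^[N]) :=
      (measurable_itinerary_of_countable hTm hζ n).comp (hTm.iterate N)
    let φ : (Fin n → Z) → (Fin (r * N) → Fin k) := fun v i => ρ (v ⟨i, by omega⟩)
    have hφ : φ ∘ (itinerary T ζ n ∘ T^[N]) = itinerary T (ρ ∘ ζ) (r * N) ∘ T^[N] := by
      ext x i
      simp [φ, itinerary]
    have h1 := partitionEntropy_prod_sub_le_comp μ (measurable_itinerary hTm hξ N) hηm φ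
    rw [hφ, partitionEntropy_comp_measurePreserving (hT.iterate N)
      (measurable_itinerary hTm hξ (r * N))] at h1
    have h2 : itinerary T (ρ ∘ ζ) (N + r * N) = Fin.appendEquiv N (r * N) ∘
        fun x => (itinerary T (ρ ∘ ζ) N x, (itinerary T (ρ ∘ ζ) (r * N) ∘ T^[N]) x) := by
      ext x j
      refine Fin.addCases (fun i => ?_) (fun i => ?_) j
      · simp [itinerary]
      · simp [itinerary, Function.iterate_add_apply, Nat.add_comm N]
    have h3 : (r + 1) * N = N + r * N := by ring
    rw [h3, h2, partitionEntropy_comp_equiv]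
    push_cast
    linarith

/-- The spread is used at rate `R = log k`, where the weight `k ^ (-m)` of meeting pasts is below
the collision probability `s = k ^ (-m / 2)` of a random colouring. On mass `1 / 2` this gives
conditional entropy at least `m * log k / 4 - 1` per block of length `2 * m`. -/
theorem HasSpreadFibres.exists_entropyRate_ge [IsProbabilityMeasure μ]
    (hT : MeasurePreserving T μ μ) (h : HasSpreadFibres T μ) {k : ℕ} (hk : 0 < k) :
    ∃ ξ : I → Fin k, Measurable ξ ∧ Real.log k / 8 - 1 ≤ entropyRate T μ ξ := by
  have hTm := hT.measurable
  obtain ⟨m, hm, g, hg, hg1, l, Q, hQ, hb⟩ := h (Real.log k) (1 / 4) (by norm_num)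
  obtain ⟨l', θ, hθ, hsep⟩ := h.exists_separating_labelling hT m (ε := 1 / 4) (by norm_num)
  -- The spread of `g` at times `0, …, m - 1` becomes a spread of `g₁` at times `m, …, 2 * m - 1`,
  -- leaving the first `m` times for the colours.
  obtain ⟨g₁, hg₁, hmap⟩ := exists_measure_le_map_eq (hT.iterate m) hg
  set Y := {x | ¬ Function.Injective (itinerary T θ m x)} with hY
  have hYm : MeasurableSet Y :=
    measurable_itinerary hTm hθ m (MeasurableSet.of_discrete (s := {u | ¬ Function.Injective u}))
  have hf : IsFiniteMeasure g := isFiniteMeasure_of_le μ hg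
  have hf₁ : IsFiniteMeasure g₁ := isFiniteMeasure_of_le μ hg₁
  set g₂ := g₁.restrict Yᶜ with hg₂
  have hmass : 1 / 2 ≤ g₂.real Set.univ := by
    have e1 : g₁.real Set.univ = g.real Set.univ := by
      rw [← hmap, map_measureReal_apply (hTm.iterate m) MeasurableSet.univ, Set.preimage_univ]
    have e2 : g₂.real Set.univ = g₁.real Yᶜ := by simp [g₂]
    have e3 := measureReal_add_measureReal_compl (μ := g₁) hYm
    have e4 : g₁.real Y ≤ μ.real Y := ENNReal.toReal_mono (measure_ne_top _ _) (hg₁ Y)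
    linarith
  have hkR : (0 : ℝ) < k := by exact_mod_cast hk
  set s : ℝ := Real.exp (-(Real.log k * m / 2)) with hs
  have hs2 : s ^ 2 * (k : ℝ) ^ m = 1 := by
    have : (k : ℝ) ^ m = Real.exp (Real.log k * m) := by
      rw [mul_comm, ← Real.log_pow, Real.exp_log (by positivity)]
    rw [this, hs, ← Real.exp_nat_mul, ← Real.exp_add, Real.exp_eq_one_iff]
    push_cast
    ring
  have hlk : 0 ≤ Real.log k := Real.log_natCast_nonneg k
  have hq : Real.exp (-(Real.log k * m)) ≤ s := Real.exp_le_exp.2 (by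
    have : 0 ≤ Real.log k * m := by positivity
    linarith)
  have hcol := exists_colouring_condEntropy_ge hT hk hQ hθ
    (Measure.restrict_le_self.trans hg₁ : g₂ ≤ μ)
    (Real.exp_nonneg (-(Real.log k * m))) (fun A D hD => by
      have hAD : MeasurableSet (itinerary T Q m ⁻¹' {A} ∩ T^[m] ⁻¹' D) :=
        (measurable_itinerary hTm hQ m (measurableSet_singleton A)).inter (hTm.iterate m hD)
      refine le_trans ?_ (hb A D hD)
      rw [← hmap, map_measureReal_apply (hTm.iterate m) hAD]
      have e : T^[2 * m] ⁻¹' D = T^[m] ⁻¹' (T^[m] ⁻¹' D) := by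
        rw [two_mul, Function.iterate_add, Set.preimage_comp]
      rw [e, Set.preimage_inter]
      exact ENNReal.toReal_mono (measure_ne_top _ _) (Measure.restrict_le_self _))
    (by rw [← hY, Measure.restrict_apply hYm]; simp) (Real.exp_pos _) hs2.ge
  choose ρ hρ using hcol
  -- The good colouring depends on the length `n` of the observed future, but there are finitely
  -- many colourings, so one of them is good for infinitely many `n`.
  obtain ⟨ρ₀, hρ₀⟩ := Finite.exists_infinite_fiber ρ
  set ζ : I → (Fin (2 * m) → Fin l) × Fin l' := fun x => (itinerary T Q (2 * m) x, θ x) with hζ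
  have hζm : Measurable ζ := (measurable_itinerary hTm hQ _).prodMk hθ
  have hξ : Measurable (ρ₀ ∘ ζ) := (measurable_of_finite ρ₀).comp hζm
  refine ⟨ρ₀ ∘ ζ, hξ, ?_⟩
  have hinf : (ρ ⁻¹' {ρ₀}).Infinite := Set.infinite_coe_iff.1 hρ₀
  have hiter := partitionEntropy_itinerary_mul_ge hT hζm ρ₀ (N := 2 * m)
    (c := Real.log k * m / 4 - 1) (fun n₀ => by
      obtain ⟨n, hn, hn₀⟩ := hinf.exists_gt n₀
      refine ⟨n, hn₀.le, ?_⟩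
      have hn : ρ n = ρ₀ := hn
      rw [← hn]
      refine le_trans ?_ (hρ n)
      have l1 : Real.log (Real.exp (-(Real.log k * m)) + s) ≤
          Real.log 2 - Real.log k * m / 2 := by
        calc _ ≤ Real.log (2 * s) := Real.log_le_log (by positivity) (by linarith)
          _ = Real.log 2 + Real.log s := Real.log_mul (by norm_num) (Real.exp_pos _).ne'
          _ = _ := by rw [hs, Real.log_exp]; ring
      have l2 : Real.log 2 ≤ 1 := by linarith [Real.log_two_lt_d9]
      have l3 : 0 ≤ Real.log k * m := by positivity
      nlinarith)
  have hlim := (tendsto_entropyRate hT hξ).comp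
    (tendsto_id.atTop_mul_const' (r := 2 * m) (by omega) : Tendsto (fun r : ℕ => r * (2 * m)) atTop atTop)
  refine ge_of_tendsto hlim ?_
  filter_upwards [eventually_ge_atTop 1] with r hr
  have hr' : (1 : ℝ) ≤ r := by exact_mod_cast hr
  have hm' : (1 : ℝ) ≤ m := by exact_mod_cast hm
  simp only [Function.comp_apply]
  rw [le_div_iff₀ (by push_cast; positivity)]
  refine le_trans ?_ (hiter r)
  push_cast
  nlinarith

theorem HasSpreadFibres.ksMeanDim_pos [IsProbabilityMeasure μ]
    (hT : MeasurePreserving T μ μ) (h : HasSpreadFibres T μ) : 0 < ksMeanDim T μ := by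
  have hlog : Tendsto (fun k : ℕ => Real.log k) atTop atTop :=
    Real.tendsto_log_atTop.comp tendsto_natCast_atTop_atTop
  -- For `log k ≥ 16` the bound `log k / 8 - 1` is at least `log k / 16`.
  refine lt_of_lt_of_le (b := ((1 / 16 : ℝ) : EReal)) (by exact_mod_cast (by norm_num)) ?_
  refine le_liminf_of_le (by isBoundedDefault) ?_
  filter_upwards [hlog.eventually_ge_atTop 16, eventually_gt_atTop 0] with k hk hk0
  obtain ⟨ξ, hξ, hent⟩ := h.exists_entropyRate_ge hT hk0
  refine le_iSup_of_le ⟨ξ, hξ⟩ ?_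
  rw [EReal.coe_le_coe_iff, le_div_iff₀ (by linarith)]
  linarith

end SpreadFibres

/-! ### Backward orbits of discrete distributions -/

section Lift

variable {X : Type*} {T : X → X} {V : Set X}

/-- A distribution on `V` lifts, through a family of sets that `T^[n]` maps over `V`, to a
distribution on `V` whose conditional distributions on the fibres are spread over the family. -/
theorem exists_spread_lift {ι : Type*} [Fintype ι] [Nonempty ι] {C : ι → Set X} {n : ℕ}
    (hCV : ∀ l, C l ⊆ V) (hC : ∀ l, V ⊆ T^[n] '' C l) (p : PMF X) (hp : p.support ⊆ V) :
    ∃ p' : PMF X, p'.support ⊆ V ∧ p'.map T^[n] = p ∧ ∀ U : Set X,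
      (∀ l l', (U ∩ C l).Nonempty → (U ∩ C l').Nonempty → l = l') → ∀ D : Set X,
        p'.toOuterMeasure (U ∩ T^[n] ⁻¹' D) ≤
          (Fintype.card ι : ENNReal)⁻¹ * p'.toOuterMeasure (T^[n] ⁻¹' D) := by
  classical
  have hex : ∀ l y, ∃ x, y ∈ V → x ∈ C l ∧ T^[n] x = y := by
    intro l y
    by_cases hy : y ∈ V
    · obtain ⟨x, hx, hxy⟩ := hC l hy
      exact ⟨x, fun _ => ⟨hx, hxy⟩⟩
    · exact ⟨y, fun h => absurd h hy⟩
  choose pick hpick using hex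
  have hmem : ∀ y, p y ≠ 0 → y ∈ V := fun y hy => hp ((PMF.mem_support_iff p y).2 hy)
  -- Given the image `y`, a branch is drawn uniformly and the chosen preimage of `y` in it is taken.
  -- A set that meets only one branch then has conditional probability at most `1 / card ι`.
  let F : X → PMF X := fun y => (PMF.uniformOfFintype ι).map fun l => pick l y
  refine ⟨p.bind F, ?_, ?_, fun U hU D => ?_⟩
  · intro x hx
    obtain ⟨y, hy, hx⟩ := (PMF.mem_support_bind_iff _ _ _).1 hx
    obtain ⟨l, -, rfl⟩ := (PMF.mem_support_map_iff _ _ _).1 hx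
    exact hCV l (hpick l y (hp hy)).1
  · rw [PMF.map_bind]
    conv_rhs => rw [← PMF.bind_pure p]
    ext x
    simp only [PMF.bind_apply]
    refine tsum_congr fun y => ?_
    by_cases hy : p y = 0
    · simp [hy]
    · congr 2
      have : T^[n] ∘ (fun l => pick l y) = Function.const ι y :=
        funext fun l => (hpick l y (hmem y hy)).2
      rw [PMF.map_comp, this, PMF.map_const]
  · rw [PMF.toOuterMeasure_bind_apply, PMF.toOuterMeasure_bind_apply, ← ENNReal.tsum_mul_left]
    refine ENNReal.tsum_le_tsum fun y => ?_
    by_cases hy : p y = 0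
    · simp [hy]
    have hyV := hmem y hy
    rw [mul_left_comm]
    refine mul_le_mul_right ?_ _
    simp only [F, PMF.toOuterMeasure_map_apply]
    by_cases hD : y ∈ D
    · have e1 : (fun l => pick l y) ⁻¹' (T^[n] ⁻¹' D) = Set.univ := by
        ext l
        simp [(hpick l y hyV).2, hD]
      have e2 : (PMF.uniformOfFintype ι).toOuterMeasure Set.univ = 1 :=
        (PMF.toOuterMeasure_apply_eq_one_iff _ _).2 (Set.subset_univ _)
      rw [e1, e2, mul_one, PMF.toOuterMeasure_uniformOfFintype_apply, div_eq_mul_inv]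
      refine mul_le_of_le_one_left' ?_
      have hsub : Subsingleton ((fun l => pick l y) ⁻¹' (U ∩ T^[n] ⁻¹' D)) := by
        refine ⟨fun a b => Subtype.ext (hU _ _ ⟨_, a.2.1, (hpick _ y hyV).1⟩ ⟨_, b.2.1, (hpick _ y hyV).1⟩)⟩
      exact_mod_cast Fintype.card_le_one_iff_subsingleton.2 hsub
    · have e1 : (fun l => pick l y) ⁻¹' (U ∩ T^[n] ⁻¹' D) = ∅ := by
        ext l
        simp [(hpick l y hyV).2, hD]
      simp [e1]

end Lift

/-- The distribution `p` gives conditional probability at most `q`, given the orbit after time `B`,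
to each set of points whose orbits stay `δ`-close until time `B`. -/
def PMF.SpreadAt (T : I → I) (B : ℕ) (δ : ℝ) (q : ENNReal) (p : PMF I) : Prop :=
  ∀ A : Set I, (∀ i < B, ∀ x ∈ A, ∀ y ∈ A, dist (T^[i] x) (T^[i] y) < δ) → ∀ D : Set I,
    p.toOuterMeasure (A ∩ T^[B] ⁻¹' D) ≤ q * p.toOuterMeasure (T^[B] ⁻¹' D)

/-- Spread passes to distributions further back: points that stay `δ`-close until time `B` are
`δ`-close at time `i`, hence lie in the same branch there. As `i + n ≤ B`, an event after time `B`
is also one after time `i + n`. -/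
theorem PMF.spreadAt_of_map {T : I → I} {ι : Type*} {C : ι → Set I} {δ : ℝ} {q : ENNReal}
    {n B i : ℕ} (hδ : ∀ l l', l ≠ l' → ∀ x ∈ C l, ∀ y ∈ C l', δ ≤ dist x y) {p p' : PMF I}
    (hp' : ∀ U : Set I, (∀ l l', (U ∩ C l).Nonempty → (U ∩ C l').Nonempty → l = l') → ∀ D : Set I,
        p'.toOuterMeasure (U ∩ T^[n] ⁻¹' D) ≤ q * p'.toOuterMeasure (T^[n] ⁻¹' D))
    (hp : p.map T^[i] = p') (hi : i < B) (hin : i + n ≤ B) : p.SpreadAt T B δ q := by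
  intro A hA D
  have hTB : T^[B] ⁻¹' D = T^[i] ⁻¹' (T^[n] ⁻¹' (T^[B - i - n] ⁻¹' D)) := by
    rw [← Set.preimage_comp, ← Set.preimage_comp, ← Function.iterate_add, ← Function.iterate_add]
    congr 2
    omega
  have h1 := hp' (T^[i] '' A) ?_ (T^[B - i - n] ⁻¹' D)
  · rw [← hp, PMF.toOuterMeasure_map_apply, PMF.toOuterMeasure_map_apply, ← hTB] at h1
    refine le_trans (measure_mono ?_) h1
    rw [Set.preimage_inter, ← hTB]
    exact Set.inter_subset_inter_left _ (Set.subset_preimage_image _ _)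
  · rintro l l' ⟨_, ⟨x, hx, rfl⟩, hxl⟩ ⟨_, ⟨y, hy, rfl⟩, hyl⟩
    by_contra hne
    exact absurd (hA i hi x hx y hy) (not_lt.2 (hδ l l' hne _ hxl _ hyl))

section Blocks

open Classical in
/-- Each distribution on `V` has a backward orbit of length `N` of distributions that ends in `V`,
and all but `b j` of its members satisfy `S j`, for all `j`. -/
def HasBackwardBlock {X : Type*} (T : X → X) (V : Set X) (S : ℕ → PMF X → Prop) (N : ℕ)
    (b : ℕ → ℕ) : Prop :=
  ∀ p : PMF X, p.support ⊆ V → ∃ m : ℕ → PMF X, m 0 = p ∧ (∀ s < N, (m (s + 1)).map T = m s) ∧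
    (m N).support ⊆ V ∧ ∀ j, (∑ s ∈ Finset.range N, if S j (m s) then 0 else 1) ≤ b j

variable {X : Type*} {T : X → X} {V : Set X} {S : ℕ → PMF X → Prop}

theorem map_iterate_of_backward {m : ℕ → PMF X} {N : ℕ} (h : ∀ s < N, (m (s + 1)).map T = m s)
    (s i : ℕ) (hi : s + i ≤ N) : (m (s + i)).map T^[i] = m s := by
  induction i with
  | zero => exact PMF.map_id _
  | succ i ih =>
    rw [Function.iterate_succ, ← PMF.map_comp, ← Nat.add_assoc, h _ (by omega), ih (by omega)]

theorem exists_backward_concat {m₁ m₂ : ℕ → PMF X} {N₁ N₂ : ℕ}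
    (h₁ : ∀ s < N₁, (m₁ (s + 1)).map T = m₁ s) (h₂ : ∀ s < N₂, (m₂ (s + 1)).map T = m₂ s)
    (h : m₂ 0 = m₁ N₁) : ∃ m : ℕ → PMF X, (∀ s ≤ N₁, m s = m₁ s) ∧ (∀ s, m (N₁ + s) = m₂ s) ∧
      ∀ s < N₁ + N₂, (m (s + 1)).map T = m s := by
  obtain ⟨m, hm⟩ : ∃ m : ℕ → PMF X, ∀ s, m s = if s < N₁ then m₁ s else m₂ (s - N₁) :=
    ⟨_, fun _ => rfl⟩
  have e1 : ∀ s ≤ N₁, m s = m₁ s := by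
    intro s hs
    rcases hs.lt_or_eq with hs | rfl
    · simp [hm, hs]
    · simp [hm, h]
  have e2 : ∀ s, m (N₁ + s) = m₂ s := by simp [hm]
  refine ⟨m, e1, e2, fun s hs => ?_⟩
  rcases lt_or_ge s N₁ with h' | h'
  · rw [e1 s h'.le, e1 (s + 1) h', h₁ s h']
  · obtain ⟨t, rfl⟩ := Nat.exists_eq_add_of_le h'
    rw [Nat.add_assoc, e2, e2, h₂ t (by omega)]

theorem HasBackwardBlock.zero : HasBackwardBlock T V S 0 0 :=
  fun p hp => ⟨fun _ => p, rfl, by simp, hp, by simp⟩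

theorem HasBackwardBlock.add {N₁ N₂ : ℕ} {b₁ b₂ : ℕ → ℕ} (h₁ : HasBackwardBlock T V S N₁ b₁)
    (h₂ : HasBackwardBlock T V S N₂ b₂) : HasBackwardBlock T V S (N₁ + N₂) (b₁ + b₂) := by
  intro p hp
  obtain ⟨m₁, a1, a2, a3, a4⟩ := h₁ p hp
  obtain ⟨m₂, c1, c2, c3, c4⟩ := h₂ _ a3
  obtain ⟨m, e1, e2, e3⟩ := exists_backward_concat a2 c2 c1
  refine ⟨m, (e1 0 (Nat.zero_le _)).trans a1, e3, by rwa [e2], fun j => ?_⟩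
  rw [Finset.sum_range_add]
  refine add_le_add ((Finset.sum_congr rfl fun s hs => ?_).trans_le (a4 j)) ?_
  · rw [e1 s (Finset.mem_range.1 hs).le]
  · exact (Finset.sum_congr rfl fun s _ => by rw [e2]).trans_le (c4 j)

theorem HasBackwardBlock.mul {N : ℕ} {b : ℕ → ℕ} (h : HasBackwardBlock T V S N b) (r : ℕ) :
    HasBackwardBlock T V S (r * N) (fun j => r * b j) := by
  induction r with
  | zero =>
    simp only [Nat.zero_mul]
    exact HasBackwardBlock.zero
  | succ r ih =>
    convert ih.add h using 1
    · ring
    · ext j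
      simp
      ring

open Classical in
/-- A backward block that starts with a lift after which all distributions satisfy `S j₀`. -/
theorem HasBackwardBlock.lift_add {n N j₀ : ℕ} {b : ℕ → ℕ} (h : HasBackwardBlock T V S N b)
    (hl : ∀ p : PMF X, p.support ⊆ V → ∃ p' : PMF X, p'.support ⊆ V ∧ p'.map T^[n] = p ∧
      ∀ i < N, ∀ p'' : PMF X, p''.map T^[i] = p' → S j₀ p'') :
    HasBackwardBlock T V S (n + N) (fun j => if j = j₀ then n else n + b j) := by
  intro p hp
  obtain ⟨p', b1, b2, b3⟩ := hl p hp
  obtain ⟨m₂, c1, c2, c3, c4⟩ := h p' b1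
  -- The distributions between `p` and its lift `p'` are images of `p'`. Nothing is claimed about
  -- them, so these `n` terms count as bad.
  obtain ⟨m₁, hm₁⟩ : ∃ m₁ : ℕ → PMF X, ∀ s, m₁ s = p'.map T^[n - s] := ⟨_, fun _ => rfl⟩
  have a2 : ∀ s < n, (m₁ (s + 1)).map T = m₁ s := by
    intro s hs
    have : n - s = n - (s + 1) + 1 := by omega
    rw [hm₁, hm₁, PMF.map_comp, this, Function.iterate_succ']
  obtain ⟨m, e1, e2, e3⟩ := exists_backward_concat a2 c2 (c1.trans (by
    rw [hm₁, Nat.sub_self]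
    exact (PMF.map_id _).symm))
  refine ⟨m, (e1 0 (Nat.zero_le _)).trans ((hm₁ 0).trans b2), e3, by rwa [e2], fun j => ?_⟩
  have h1 : (∑ s ∈ Finset.range n, if S j (m s) then 0 else 1) ≤ n := by
    calc _ ≤ ∑ _s ∈ Finset.range n, 1 := Finset.sum_le_sum fun s _ => by split_ifs <;> simp
      _ = n := by simp
  have h3 : (∑ s ∈ Finset.range N, if S j (m (n + s)) then 0 else 1) =
      ∑ s ∈ Finset.range N, if S j (m₂ s) then 0 else 1 :=
    Finset.sum_congr rfl fun s _ => by rw [e2]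
  show _ ≤ if j = j₀ then n else n + b j
  rw [Finset.sum_range_add, h3]
  split_ifs with hj
  · subst hj
    have h2 : (∑ s ∈ Finset.range N, if S j (m₂ s) then 0 else 1) = 0 := by
      refine Finset.sum_eq_zero fun s hs => if_pos (b3 s (Finset.mem_range.1 hs) _ ?_)
      have := map_iterate_of_backward c2 0 s (by have := Finset.mem_range.1 hs; omega)
      rwa [Nat.zero_add, c1] at this
    omega
  · exact add_le_add h1 (c4 j)

end Blocks

/-! ### Horseshoes -/

/-- At least `L` pairwise disjoint closed subsets of `V` are mapped over `W` by `T^[n]`. -/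
def HasCovering {X : Type*} [TopologicalSpace X] (T : X → X) (V W : Set X) (n : ℕ) (L : ℝ) : Prop :=
  ∃ (ι : Type) (_ : Fintype ι) (C : ι → Set X), L ≤ Fintype.card ι ∧ (∀ l, IsClosed (C l)) ∧
    (∀ l, C l ⊆ V) ∧ (∀ l, W ⊆ T^[n] '' C l) ∧ Pairwise fun l l' => Disjoint (C l) (C l')

theorem exists_separation_of_disjoint {ι X : Type*} [Finite ι] [MetricSpace X] [CompactSpace X]
    {C : ι → Set X} (hC : ∀ l, IsClosed (C l)) (hd : Pairwise fun l l' => Disjoint (C l) (C l')) :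
    ∃ δ > 0, ∀ l l', l ≠ l' → ∀ x ∈ C l, ∀ y ∈ C l', δ ≤ dist x y := by
  have h : ∀ᶠ δ : ℝ in 𝓝[>] 0, ∀ l l', l ≠ l' → ∀ x ∈ C l, ∀ y ∈ C l', δ ≤ dist x y := by
    refine eventually_all.2 fun l => eventually_all.2 fun l' => ?_
    by_cases hl : l = l'
    · exact Eventually.of_forall fun δ h => absurd hl h
    · obtain ⟨r, hr, h⟩ := Metric.exists_pos_forall_lt_edist (hC l).isCompact (hC l') (hd hl)
      filter_upwards [Ioo_mem_nhdsGT (show (0 : ℝ) < r from hr)] with δ hδ _ x hx y hy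
      have := h x hx y hy
      rw [edist_nndist, ENNReal.coe_lt_coe] at this
      have : (r : ℝ) < dist x y := this
      linarith [hδ.2]
  obtain ⟨δ, h1, h2⟩ := (h.and self_mem_nhdsWithin).exists
  exact ⟨δ, h2, h1⟩

/-- The branches are finitely many disjoint compact sets, hence `δ`-separated. A uniform choice
among at least `exp r` of them gives conditional probabilities at most `exp (-r)`. -/
theorem HasCovering.exists_spread_lift {T : I → I} {V : Set I} {n : ℕ} {r : ℝ}
    (h : HasCovering T V V n (Real.exp r)) :
    ∃ δ > 0, ∀ p : PMF I, p.support ⊆ V → ∃ p' : PMF I, p'.support ⊆ V ∧ p'.map T^[n] = p ∧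
      ∀ B i, i < B → i + n ≤ B → ∀ p'' : PMF I, p''.map T^[i] = p' →
        p''.SpreadAt T B δ (ENNReal.ofReal (Real.exp (-r))) := by
  obtain ⟨ι, _, C, hL, hcl, hCV, hC, hd⟩ := h
  have hpos : 0 < Fintype.card ι := by
    have := (Real.exp_pos r).trans_le hL
    exact_mod_cast this
  have : Nonempty ι := Fintype.card_pos_iff.1 hpos
  obtain ⟨δ, hδ, hsep⟩ := exists_separation_of_disjoint hcl hd
  refine ⟨δ, hδ, fun p hp => ?_⟩
  obtain ⟨p', h1, h2, h3⟩ := _root_.exists_spread_lift hCV hC p hp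
  refine ⟨p', h1, h2, fun B i hi hin p'' hp'' => ?_⟩
  refine PMF.spreadAt_of_map hsep (fun U hU D => (h3 U hU D).trans ?_) hp'' hi hin
  refine mul_le_mul_left ?_ _
  rw [Real.exp_neg, ENNReal.ofReal_inv_of_pos (Real.exp_pos r)]
  refine ENNReal.inv_le_inv.2 ?_
  rw [← ENNReal.ofReal_natCast]
  exact ENNReal.ofReal_le_ofReal hL

/-- Horseshoes over `V` with super-linear entropy produce long backward orbits of distributions most
of which are spread at all scales. -/
theorem exists_backward_blocks {T : I → I} {V : Set I}
    (h : ∀ R : ℕ, ∃ n ≥ 1, HasCovering T V V n (Real.exp (R * n))) :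
    ∃ (B : ℕ → ℕ) (δ : ℕ → ℝ), (∀ j, j ≤ B j) ∧ (∀ j, 0 < δ j) ∧ ∀ J, ∃ b : ℕ → ℕ,
      HasBackwardBlock T V
        (fun j => PMF.SpreadAt T (B j) (δ j) (ENNReal.ofReal (Real.exp (-(j * B j))))) (B J) b ∧
      ∀ j, 2 ≤ j → j ≤ J → (b j : ℝ) ≤ (2 / 2 ^ j - 1 / 2 ^ J) * B J := by
  choose n hn hcov using h
  choose δ hδ hlift using fun R => (hcov R).exists_spread_lift
  -- Block `j + 1` is one lift of length `n` followed by `n * 2 ^ (j + 1)` copies of block `j`. The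
  -- horseshoe rate is chosen so large that this single lift yields the spread `exp (-((j + 1) * B
  -- (j + 1)))` needed for the whole block.
  obtain ⟨B, hB0, hBs⟩ : ∃ B : ℕ → ℕ, B 0 = 0 ∧ ∀ j, B (j + 1) =
      n ((j + 1) * (1 + 2 ^ (j + 1) * B j)) * (1 + 2 ^ (j + 1) * B j) :=
    ⟨fun j => Nat.rec 0 (fun j Bj =>
      n ((j + 1) * (1 + 2 ^ (j + 1) * Bj)) * (1 + 2 ^ (j + 1) * Bj)) j, rfl, fun _ => rfl⟩
  let R : ℕ → ℕ := fun j => j * (1 + 2 ^ j * B (j - 1))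
  have hB : ∀ j, B (j + 1) = n (R (j + 1)) * (1 + 2 ^ (j + 1) * B j) := hBs
  have hBj : ∀ j, j ≤ B j := by
    intro j
    induction j with
    | zero => exact Nat.zero_le _
    | succ j ih =>
      rw [hB]
      have h1 := hn (R (j + 1))
      have h2 : 1 ≤ 2 ^ (j + 1) := Nat.one_le_two_pow
      nlinarith [Nat.mul_le_mul h1 (le_refl (1 + 2 ^ (j + 1) * B j)), Nat.mul_le_mul h2 ih]
  refine ⟨B, fun j => δ (R j), hBj, fun j => hδ _, fun J => ?_⟩
  induction J with
  | zero => exact ⟨0, by rw [hB0]; exact HasBackwardBlock.zero, fun j h2 h0 => by omega⟩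
  | succ J ih =>
    obtain ⟨b, hb, hbj⟩ := ih
    set r := n (R (J + 1)) * 2 ^ (J + 1) with hr
    have hBr : B (J + 1) = n (R (J + 1)) + r * B J := by rw [hB, hr]; ring
    have hblock := (hb.mul r).lift_add (n := n (R (J + 1))) (j₀ := J + 1) (fun p hp => by
      obtain ⟨p', h1, h2, h3⟩ := hlift (R (J + 1)) p hp
      refine ⟨p', h1, h2, fun i hi p'' hp'' => ?_⟩
      have := h3 (B (J + 1)) i (by omega) (by omega) p'' hp''
      have e : ((R (J + 1) : ℕ) : ℝ) * n (R (J + 1)) = ((J + 1 : ℕ) : ℝ) * B (J + 1) := by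
        rw [hB]
        simp only [R, Nat.add_sub_cancel]
        push_cast
        ring
      rwa [e] at this)
    rw [← hBr] at hblock
    refine ⟨_, hblock, fun j h2 hjJ => ?_⟩
    have hBR : (B (J + 1) : ℝ) = n (R (J + 1)) + r * (B J : ℝ) := by exact_mod_cast hBr
    have hBR' : (B (J + 1) : ℝ) = n (R (J + 1)) * (1 + 2 ^ (J + 1) * B J) := by
      exact_mod_cast hB J
    have hn0 : (0 : ℝ) ≤ n (R (J + 1)) := Nat.cast_nonneg _
    have h2J : (0 : ℝ) < 2 ^ J := by positivity
    -- The lift fills at most a fraction `2 ^ (-(J + 1))` of the block. This needs `B J ≥ 1`, hence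
    -- `J ≥ 1`, whence the restriction to `2 ≤ j`.
    have hnB : (n (R (J + 1)) : ℝ) ≤ 1 / 2 ^ (J + 1) * B (J + 1) := by
      have hBJ : (1 : ℝ) ≤ B J := by
        have := hBj J
        exact_mod_cast (by omega : 1 ≤ B J)
      rw [hBR', one_div, ← div_eq_inv_mul, le_div_iff₀ (by positivity)]
      refine mul_le_mul_of_nonneg_left ?_ hn0
      nlinarith [pow_pos (two_pos : (0 : ℝ) < 2) (J + 1)]
    have e1 : (1 : ℝ) / 2 ^ J = 2 * (1 / 2 ^ (J + 1)) := by
      rw [pow_succ]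
      field_simp
    -- For the new `j` only the lift is bad, a fraction `1 / 2 ^ j`. For older `j` the bad fraction
    -- grows by at most `1 / 2 ^ (J + 1)`; the bound `2 / 2 ^ j - 1 / 2 ^ J` is the resulting
    -- geometric sum.
    by_cases hj : j = J + 1
    · subst hj
      simp only [if_true]
      refine hnB.trans (le_of_eq ?_)
      ring
    · simp only [hj, if_false]
      push_cast
      have h3 := hbj j h2 (by omega)
      have h4 := mul_le_mul_of_nonneg_left h3 (Nat.cast_nonneg (α := ℝ) r)
      have h5 : (0 : ℝ) ≤ 2 / 2 ^ j - 1 / 2 ^ J := by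
        have : (1 : ℝ) / 2 ^ J ≤ 1 / 2 ^ j :=
          one_div_le_one_div_of_le (by positivity) (pow_le_pow_right₀ (by norm_num) (by omega))
        have h6 : (0 : ℝ) ≤ 1 / 2 ^ j := by positivity
        have h7 : (2 : ℝ) / 2 ^ j = 2 * (1 / 2 ^ j) := by ring
        linarith
      have h8 : (r : ℝ) * B J ≤ B (J + 1) := by linarith
      have h9 := mul_le_mul_of_nonneg_left h8 h5
      rw [e1] at h4 h9
      nlinarith

/-! ### Invariant limit measures -/

/-- Telescoping along a backward orbit: the average of its members is invariant up to two boundary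
terms. -/
theorem sum_integral_comp_sub_integral {T : I → I} (hT : Measurable T) {N : ℕ} {m : ℕ → PMF I}
    (h : ∀ s < N, (m (s + 1)).map T = m s) (f : C(I, ℝ)) :
    ∑ s ∈ Finset.range N, (∫ x, f x ∂(m s).toMeasure - ∫ x, f (T x) ∂(m s).toMeasure) =
      ∫ x, f (T x) ∂(m N).toMeasure - ∫ x, f (T x) ∂(m 0).toMeasure := by
  rw [← Finset.sum_range_sub (fun s => ∫ x, f (T x) ∂(m s).toMeasure)]
  refine Finset.sum_congr rfl fun s hs => ?_
  congr 1
  rw [← h s (Finset.mem_range.1 hs), ← PMF.toMeasure_map T (m (s + 1)) hT]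
  exact integral_map hT.aemeasurable f.continuous.aestronglyMeasurable

open Classical in
/-- A limit of the averages of long backward orbits of distributions is invariant, and an integral
inequality that holds for most of these distributions holds for most of the limit. -/
theorem exists_invariant_limit {T : I → I} (hT : Continuous T) {S : ℕ → PMF I → Prop} {N : ℕ → ℕ}
    (hN : ∀ J, J ≤ N J) {β : ℕ → ℝ} (h : ∀ J, ∃ m : ℕ → PMF I,
      (∀ s < N J, (m (s + 1)).map T = m s) ∧ ∀ j, 2 ≤ j → j ≤ J →
        ((∑ s ∈ Finset.range (N J), if S j (m s) then 0 else 1 : ℕ) : ℝ) ≤ β j * N J) :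
    ∃ μ : Measure I, IsProbabilityMeasure μ ∧ MeasurePreserving T μ μ ∧ ∀ j, 2 ≤ j →
      ∃ g : Measure I, g ≤ μ ∧ 1 - β j ≤ g.real Set.univ ∧ ∀ F H : C(I, ℝ), (∀ x, 0 ≤ H x) →
        (∀ p, S j p → ∫ x, F x ∂p.toMeasure ≤ ∫ x, H x ∂p.toMeasure) →
        ∫ x, F x ∂g ≤ ∫ x, H x ∂μ := by
  choose m hm hbad using h
  let flag : ℕ → ℕ → (ℕ → Bool) := fun J s j => decide (S j (m J s))
  have hNpos : ∀ J, 0 < N (J + 1) := fun J => lt_of_lt_of_le (Nat.succ_pos J) (hN _)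
  -- Each distribution carries the sequence of flags telling which `S j` it satisfies. Averaging on
  -- the compact product with the flag space lets the good parts for all `j` converge together with
  -- the average.
  let ν : ℕ → Measure (I × (ℕ → Bool)) := fun J => (N (J + 1) : ENNReal)⁻¹ •
    ∑ s ∈ Finset.range (N (J + 1)), (m (J + 1) s).toMeasure.map fun x => (x, flag (J + 1) s)
  have hfl : ∀ J s, Measurable fun x : I => (x, flag J s) := fun J s =>
    measurable_id.prodMk measurable_const
  have hν : ∀ J, IsProbabilityMeasure (ν J) := by
    intro J
    constructor
    have h1 : ∀ s, ((m (J + 1) s).toMeasure.map fun x => (x, flag (J + 1) s)) Set.univ = 1 :=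
      fun s => by
        rw [Measure.map_apply (hfl _ _) MeasurableSet.univ, Set.preimage_univ, measure_univ]
    simp only [ν, Measure.smul_apply, Measure.finsetSum_apply, h1, Finset.sum_const,
      Finset.card_range, nsmul_eq_mul, mul_one, smul_eq_mul]
    exact ENNReal.inv_mul_cancel (by exact_mod_cast (hNpos J).ne') (ENNReal.natCast_ne_top _)
  have hint : ∀ J (Φ : C(I × (ℕ → Bool), ℝ)), ∫ z, Φ z ∂(ν J) =
      (N (J + 1) : ℝ)⁻¹ * ∑ s ∈ Finset.range (N (J + 1)),
        ∫ x, Φ (x, flag (J + 1) s) ∂(m (J + 1) s).toMeasure := by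
    intro J Φ
    have hi : ∀ s ∈ Finset.range (N (J + 1)), Integrable Φ
        ((m (J + 1) s).toMeasure.map fun x => (x, flag (J + 1) s)) := fun s _ => by
      have := Measure.isProbabilityMeasure_map (μ := (m (J + 1) s).toMeasure)
        (hfl (J + 1) s).aemeasurable
      exact (BoundedContinuousFunction.mkOfCompact Φ).integrable _
    simp only [ν]
    rw [integral_smul_measure, integral_finsetSum_measure hi, smul_eq_mul, ENNReal.toReal_inv,
      ENNReal.toReal_natCast]
    congr 1
    refine Finset.sum_congr rfl fun s _ => ?_
    exact integral_map (hfl _ _).aemeasurable Φ.continuous.aestronglyMeasurable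
  let 𝒰 : Ultrafilter ℕ := hyperfilter ℕ
  have h𝒰 : (𝒰 : Filter ℕ) ≤ atTop := Nat.hyperfilter_le_atTop
  let ν' : ℕ → ProbabilityMeasure (I × (ℕ → Bool)) := fun J => ⟨ν J, hν J⟩
  obtain ⟨P, -, hP⟩ := isCompact_univ.ultrafilter_le_nhds (𝒰.map ν') (by simp)
  have hlim : ∀ Φ : C(I × (ℕ → Bool), ℝ),
      Tendsto (fun J => ∫ z, Φ z ∂(ν J)) 𝒰 (𝓝 (∫ z, Φ z ∂(P : Measure (I × (ℕ → Bool))))) :=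
    fun Φ => ProbabilityMeasure.tendsto_iff_forall_integral_tendsto.1
      (show Tendsto ν' 𝒰 (𝓝 P) from hP)
      (BoundedContinuousFunction.mkOfCompact Φ)
  set μ : Measure I := (P : Measure (I × (ℕ → Bool))).map Prod.fst with hμ
  have hμp : IsProbabilityMeasure μ := Measure.isProbabilityMeasure_map measurable_fst.aemeasurable
  have hμint : ∀ f : C(I, ℝ), ∫ x, f x ∂μ =
      ∫ z, (f.comp ⟨Prod.fst, continuous_fst⟩ : C(I × (ℕ → Bool), ℝ)) z
        ∂(P : Measure (I × (ℕ → Bool))) := fun f =>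
    integral_map measurable_fst.aemeasurable f.continuous.aestronglyMeasurable
  have hinv : μ.map T = μ := by
    have hTp : IsProbabilityMeasure (μ.map T) :=
      Measure.isProbabilityMeasure_map hT.measurable.aemeasurable
    refine ext_of_forall_integral_eq_of_IsFiniteMeasure fun f => ?_
    rw [integral_map hT.measurable.aemeasurable f.continuous.aestronglyMeasurable]
    let f₁ : C(I, ℝ) := f.toContinuousMap
    let f₂ : C(I, ℝ) := f₁.comp ⟨T, hT⟩
    have e : ∫ x, f₁ x ∂μ - ∫ x, f₂ x ∂μ = 0 := by
      rw [hμint, hμint]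
      refine tendsto_nhds_unique ((hlim _).sub (hlim _)) ?_
      have hz : Tendsto (fun J : ℕ => 2 * ‖f‖ * (1 / ((J : ℝ) + 1))) 𝒰 (𝓝 0) := by
        have := (tendsto_one_div_add_atTop_nhds_zero_nat (𝕜 := ℝ)).const_mul (2 * ‖f‖)
        rw [mul_zero] at this
        exact this.mono_left h𝒰
      refine squeeze_zero_norm (fun J => ?_) hz
      rw [hint, hint, ← mul_sub, ← Finset.sum_sub_distrib]
      have h1 := sum_integral_comp_sub_integral hT.measurable (hm (J + 1)) f₁
      have h2 : ∀ s, ‖∫ x, f₁ (T x) ∂(m (J + 1) s).toMeasure‖ ≤ ‖f‖ := fun s => by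
        have := norm_integral_le_of_norm_le_const (μ := (m (J + 1) s).toMeasure)
          (f := fun x => f₁ (T x)) (C := ‖f‖) (Eventually.of_forall fun x => f.norm_coe_le_norm (T x))
        simpa using this
      simp only [ContinuousMap.comp_apply, ContinuousMap.coe_mk, f₂] at h1 ⊢
      rw [h1, norm_mul, norm_inv, RCLike.norm_natCast, mul_comm]
      have h3 : ((J : ℝ) + 1) ≤ N (J + 1) := by exact_mod_cast hN (J + 1)
      have h4 := (norm_sub_le (∫ x, f₁ (T x) ∂(m (J + 1) (N (J + 1))).toMeasure)
        (∫ x, f₁ (T x) ∂(m (J + 1) 0).toMeasure)).trans (add_le_add (h2 _) (h2 _))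
      rw [← two_mul] at h4
      rw [one_div]
      gcongr
    exact (sub_eq_zero.1 e).symm
  refine ⟨μ, hμp, ⟨hT.measurable, hinv⟩, fun j hj => ?_⟩
  -- The condition that flag `j` is set is clopen, so its indicator is a legitimate test function,
  -- and masses and integrals of the good part pass to the limit.
  have hind : Continuous fun z : I × (ℕ → Bool) => if z.2 j = true then (1 : ℝ) else 0 :=
    (continuous_of_discreteTopology (f := fun b : Bool => if b = true then (1 : ℝ) else 0)).comp
      ((continuous_apply j).comp continuous_snd)
  let χ : C(I × (ℕ → Bool), ℝ) := ⟨_, hind⟩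
  have hχ : ∀ z, χ z = if z.2 j = true then (1 : ℝ) else 0 := fun _ => rfl
  have hE : MeasurableSet {z : I × (ℕ → Bool) | z.2 j = true} :=
    measurableSet_eq_fun ((measurable_pi_apply j).comp measurable_snd) measurable_const
  set g := ((P : Measure (I × (ℕ → Bool))).restrict {z | z.2 j = true}).map Prod.fst with hg
  have hgint : ∀ f : C(I, ℝ), ∫ x, f x ∂g =
      ∫ z, (χ * f.comp ⟨Prod.fst, continuous_fst⟩ : C(I × (ℕ → Bool), ℝ)) z
        ∂(P : Measure (I × (ℕ → Bool))) := by
    intro f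
    rw [hg, integral_map measurable_fst.aemeasurable f.continuous.aestronglyMeasurable,
      ← integral_indicator hE]
    refine integral_congr_ae (Eventually.of_forall fun z => ?_)
    by_cases hz : z.2 j = true
    · simp [hχ, Set.indicator, hz]
    · simp [hχ, Set.indicator, hz]
  have hgμ : g ≤ μ := Measure.map_mono Measure.restrict_le_self measurable_fst
  have hgf : IsFiniteMeasure g := isFiniteMeasure_of_le μ hgμ
  have hev : ∀ᶠ J in (𝒰 : Filter ℕ), j ≤ J + 1 :=
    h𝒰 ((eventually_ge_atTop j).mono fun J h => h.trans (Nat.le_succ J))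
  refine ⟨g, hgμ, ?_, fun F H hH hFH => ?_⟩
  · have e1 : g.real Set.univ = ∫ x, (1 : C(I, ℝ)) x ∂g := by simp
    rw [e1, hgint]
    refine ge_of_tendsto (hlim _) (hev.mono fun J hJ => ?_)
    have hNR : (0 : ℝ) < N (J + 1) := by exact_mod_cast hNpos J
    rw [hint, ← div_eq_inv_mul, le_div_iff₀ hNR]
    have h1 := hbad (J + 1) j hj hJ
    have h2 : ∀ s, ∫ x, (χ * (1 : C(I, ℝ)).comp ⟨Prod.fst, continuous_fst⟩ :
        C(I × (ℕ → Bool), ℝ)) (x, flag (J + 1) s) ∂(m (J + 1) s).toMeasure =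
        1 - ((if S j (m (J + 1) s) then 0 else 1 : ℕ) : ℝ) := by
      intro s
      by_cases hs : S j (m (J + 1) s)
      · simp [hχ, flag, hs]
      · simp [hχ, flag, hs]
    simp only [h2, Finset.sum_sub_distrib, Finset.sum_const, Finset.card_range, nsmul_eq_mul,
      mul_one]
    rw [Nat.cast_sum] at h1
    linarith
  · rw [hgint, hμint]
    refine le_of_tendsto_of_tendsto (hlim _) (hlim _) (hev.mono fun J hJ => ?_)
    simp only
    rw [hint, hint]
    refine mul_le_mul_of_nonneg_left (Finset.sum_le_sum fun s _ => ?_) (by positivity)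
    by_cases hs : S j (m (J + 1) s)
    · simpa [hχ, flag, hs] using hFH _ hs
    · simpa [hχ, flag, hs] using integral_nonneg hH

/-- Spread for sets does not pass to weak limits directly. This version with continuous test
functions does, through `exists_invariant_limit`. -/
theorem PMF.SpreadAt.integral_mul_le {T : I → I} (hT : Continuous T) {B : ℕ} {δ q : ℝ} (hq : 0 ≤ q)
    {p : PMF I} (hp : p.SpreadAt T B δ (ENNReal.ofReal q)) {f h : C(I, ℝ)} (hf1 : ∀ x, f x ≤ 1) (hh : ∀ x, 0 ≤ h x)
    (hf : ∀ i < B, ∀ x y, f x ≠ 0 → f y ≠ 0 → dist (T^[i] x) (T^[i] y) < δ) :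
    ∫ x, f x * h (T^[B] x) ∂p.toMeasure ≤ ∫ x, q * h (T^[B] x) ∂p.toMeasure := by
  have hTB := hT.iterate B
  set A := {x | f x ≠ 0} with hA
  have hAm : MeasurableSet A :=
    (measurableSet_eq_fun f.continuous.measurable measurable_const).compl
  have hle : (p.toMeasure.restrict A).map T^[B] ≤
      ENNReal.ofReal q • p.toMeasure.map T^[B] := by
    refine Measure.le_iff.2 fun D hD => ?_
    have hD' : MeasurableSet (T^[B] ⁻¹' D) := hTB.measurable hD
    rw [Measure.smul_apply, Measure.map_apply hTB.measurable hD, Measure.map_apply hTB.measurable hD,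
      Measure.restrict_apply hD', smul_eq_mul, Set.inter_comm,
      PMF.toMeasure_apply_eq_toOuterMeasure_apply _ (hAm.inter hD'),
      PMF.toMeasure_apply_eq_toOuterMeasure_apply _ hD']
    exact hp A (fun i hi x hx y hy => hf i hi x y hx hy) D
  have hb : ∀ (ν : Measure I) [IsFiniteMeasure ν], Integrable h ν := fun ν _ =>
    (BoundedContinuousFunction.mkOfCompact h).integrable ν
  let h' : C(I, ℝ) := h.comp ⟨_, hTB⟩
  have hi' : Integrable (fun x => h (T^[B] x)) p.toMeasure :=
    (BoundedContinuousFunction.mkOfCompact h').integrable _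
  calc _ ≤ ∫ x, A.indicator (fun x => h (T^[B] x)) x ∂p.toMeasure := by
        refine integral_mono ((BoundedContinuousFunction.mkOfCompact (f * h')).integrable _)
          (hi'.indicator hAm) fun x => ?_
        by_cases hx : f x = 0
        · simp [A, hx]
        · have : x ∈ A := hx
          simp only [Set.indicator_of_mem this]
          exact mul_le_of_le_one_left (hh _) (hf1 x)
    _ = ∫ x in A, h (T^[B] x) ∂p.toMeasure := integral_indicator hAm
    _ = ∫ x, h x ∂((p.toMeasure.restrict A).map T^[B]) :=
        (integral_map hTB.measurable.aemeasurable h.continuous.aestronglyMeasurable).symm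
    _ ≤ ∫ x, h x ∂(ENNReal.ofReal q • p.toMeasure.map T^[B]) := by
        have : IsFiniteMeasure (ENNReal.ofReal q • p.toMeasure.map T^[B]) :=
          Measure.smul_finite _ ENNReal.ofReal_ne_top
        exact integral_mono_measure hle (Eventually.of_forall hh) (hb _)
    _ = _ := by
        rw [integral_smul_measure, ENNReal.toReal_ofReal hq,
          integral_map hTB.measurable.aemeasurable h.continuous.aestronglyMeasurable,
          integral_const_mul, smul_eq_mul]

/-- An inequality for integrals of continuous functions extends to measurable sets. -/
theorem measureReal_inter_preimage_le {g μ : Measure I} [IsFiniteMeasure g] [IsFiniteMeasure μ]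
    {S : I → I} (hS : Continuous S) {O : Set I} (hO : IsOpen O) {q : ℝ} (hq : 0 ≤ q)
    (hfh : ∀ f h : C(I, ℝ), (∀ x, 0 ≤ f x) → (∀ x, f x ≤ 1) → (∀ x, 0 ≤ h x) →
      (∀ x, f x ≠ 0 → x ∈ O) → ∫ x, f x * h (S x) ∂g ≤ q * ∫ x, h x ∂μ)
    {A D : Set I} (hAO : A ⊆ O) (hA : MeasurableSet A) (hD : MeasurableSet D) :
    g.real (A ∩ S ⁻¹' D) ≤ q * μ.real D := by
  -- For compact `K`, Urysohn functions `f` between `K` and `O` and `h` between `S '' K` and a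
  -- neighbourhood of slightly larger measure suffice. Inner regularity of `g` then gives the
  -- general case.
  have hcpt : ∀ K ⊆ O, IsCompact K → g.real K ≤ q * μ.real (S '' K) := by
    intro K hKO hK
    have hSK : IsCompact (S '' K) := hK.image hS
    refine le_of_forall_pos_le_add fun ε hε => ?_
    obtain ⟨U, hU, hUo, hμU⟩ := (S '' K).exists_isOpen_lt_add (μ := μ) (measure_ne_top _ _)
      (ε := ENNReal.ofReal (ε / (q + 1))) (ENNReal.ofReal_pos.2 (by positivity)).ne'
    have hμU' : μ.real U ≤ μ.real (S '' K) + ε / (q + 1) := by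
      have := ENNReal.toReal_mono (by finiteness) hμU.le
      rwa [ENNReal.toReal_add (measure_ne_top _ _) ENNReal.ofReal_ne_top,
        ENNReal.toReal_ofReal (by positivity)] at this
    obtain ⟨f, hf0, hf1, hf⟩ := exists_continuous_zero_one_of_isClosed hO.isClosed_compl hK.isClosed
      (Set.disjoint_left.2 fun x hx hxK => hx (hKO hxK))
    obtain ⟨h, hh0, hh1, hh⟩ := exists_continuous_zero_one_of_isClosed hUo.isClosed_compl
      hSK.isClosed (Set.disjoint_left.2 fun x hx hxK => hx (hU hxK))
    have h1 := hfh f h (fun x => (hf x).1) (fun x => (hf x).2) (fun x => (hh x).1) (fun x hx => by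
      by_contra hxO
      exact hx (hf0 hxO))
    have h2 : g.real K ≤ ∫ x, f x * h (S x) ∂g := by
      rw [← integral_indicator_one hK.measurableSet]
      refine integral_mono ((integrable_const (1 : ℝ)).indicator hK.measurableSet)
        ((BoundedContinuousFunction.mkOfCompact (f * h.comp ⟨S, hS⟩)).integrable _) fun x => ?_
      by_cases hx : x ∈ K
      · simp [hx, hf1 hx, hh1 (Set.mem_image_of_mem S hx)]
      · simp only [Set.indicator_of_notMem hx]
        exact mul_nonneg (hf x).1 (hh _).1
    have h3 : ∫ x, h x ∂μ ≤ μ.real U := by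
      rw [← integral_indicator_one hUo.measurableSet]
      refine integral_mono ((BoundedContinuousFunction.mkOfCompact h).integrable _)
        ((integrable_const (1 : ℝ)).indicator hUo.measurableSet) fun x => ?_
      by_cases hx : x ∈ U
      · simpa [hx] using (hh x).2
      · simp [hx, hh0 (show x ∈ Uᶜ from hx)]
    have h4 : q * (ε / (q + 1)) ≤ ε := by
      rw [mul_div_assoc', div_le_iff₀ (by positivity)]
      nlinarith
    have h5 := mul_le_mul_of_nonneg_left (h3.trans hμU') hq
    rw [mul_add] at h5
    linarith
  have hM : MeasurableSet (A ∩ S ⁻¹' D) := hA.inter (hS.measurable hD)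
  refine le_of_forall_pos_le_add fun ε hε => ?_
  obtain ⟨K, hKs, hK, hlt⟩ := hM.exists_isCompact_lt_add (μ := g) (measure_ne_top _ _)
    (ε := ENNReal.ofReal ε) (ENNReal.ofReal_pos.2 hε).ne'
  have h1 : g.real (A ∩ S ⁻¹' D) ≤ g.real K + ε := by
    have := ENNReal.toReal_mono (by finiteness) hlt.le
    rwa [ENNReal.toReal_add (measure_ne_top _ _) ENNReal.ofReal_ne_top,
      ENNReal.toReal_ofReal hε.le] at this
  have h2 := hcpt K (fun x hx => hAO (hKs hx).1) hK
  have h3 : μ.real (S '' K) ≤ μ.real D :=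
    measureReal_mono (Set.image_subset_iff.2 fun x hx => (hKs hx).2)
  have h4 := mul_le_mul_of_nonneg_left h3 hq
  linarith

/-- A continuous map with horseshoes of super-linear entropy over a fixed set has an invariant
probability measure with spread fibres. -/
theorem exists_hasSpreadFibres {T : I → I} (hT : Continuous T) {V : Set I} (hV : V.Nonempty)
    (h : ∀ R : ℕ, ∃ n ≥ 1, HasCovering T V V n (Real.exp (R * n))) :
    ∃ μ : Measure I, IsProbabilityMeasure μ ∧ MeasurePreserving T μ μ ∧ HasSpreadFibres T μ := by
  obtain ⟨B, δ, hB, hδ, hblock⟩ := exists_backward_blocks h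
  obtain ⟨y, hy⟩ := hV
  obtain ⟨μ, hμ, hinv, hlim⟩ := exists_invariant_limit hT (S := fun j =>
      PMF.SpreadAt T (B j) (δ j) (ENNReal.ofReal (Real.exp (-(j * B j))))) hB
    (β := fun j => 2 / 2 ^ j) (fun J => by
      obtain ⟨b, hb, hbj⟩ := hblock J
      obtain ⟨m, -, h2, -, h4⟩ := hb (PMF.pure y) (by simpa using hy)
      refine ⟨m, h2, fun j hj hjJ => ?_⟩
      refine (Nat.cast_le.2 (h4 j)).trans ((hbj j hj hjJ).trans ?_)
      gcongr
      have : (0 : ℝ) ≤ 1 / 2 ^ J := by positivity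
      linarith)
  refine ⟨μ, hμ, hinv, fun R η hη => ?_⟩
  obtain ⟨j, hjR, hjη, hj2⟩ : ∃ j : ℕ, R ≤ j ∧ (2 : ℝ) / 2 ^ j < η ∧ 2 ≤ j := by
    have h1 : Tendsto (fun j : ℕ => (2 : ℝ) / 2 ^ j) atTop (𝓝 0) :=
      tendsto_const_nhds.div_atTop (tendsto_pow_atTop_atTop_of_one_lt (by norm_num))
    exact ((tendsto_natCast_atTop_atTop.eventually_ge_atTop R).and
      ((h1.eventually (gt_mem_nhds hη)).and (eventually_ge_atTop 2))).exists
  obtain ⟨g, hg, hg1, hFH⟩ := hlim j hj2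
  have hgf : IsFiniteMeasure g := isFiniteMeasure_of_le μ hg
  obtain ⟨l, Q, hQ, hQδ⟩ := exists_fine_labelling (ε := δ j / 3) (by linarith [hδ j])
  refine ⟨B j, by linarith [hB j], g, hg, by linarith, l, Q, hQ, fun A D hD => ?_⟩
  set q := Real.exp (-(j * B j)) with hq
  have hq0 : 0 ≤ q := Real.exp_nonneg _
  have hqR : q ≤ Real.exp (-(R * B j)) :=
    Real.exp_le_exp.2 (neg_le_neg (mul_le_mul_of_nonneg_right hjR (Nat.cast_nonneg _)))
  refine le_trans ?_ (mul_le_mul_of_nonneg_right hqR measureReal_nonneg)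
  -- An open neighbourhood of the cylinder is needed to fit continuous functions. Cells of diameter
  -- at most `δ j / 3`, thickened by `δ j / 3` on either side, keep orbits `δ j`-close.
  let O : Set I := ⋂ i : Fin (B j), T^[i] ⁻¹' (⋃ z ∈ Q ⁻¹' {A i}, Metric.ball z (δ j / 3))
  have hO : IsOpen O := isOpen_iInter_of_finite fun i =>
    (isOpen_biUnion fun z _ => Metric.isOpen_ball).preimage (hT.iterate i)
  have hclose : ∀ i < B j, ∀ x ∈ O, ∀ x' ∈ O, dist (T^[i] x) (T^[i] x') < δ j := by
    intro i hi x hx x' hx'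
    have a := Set.mem_iInter.1 hx ⟨i, hi⟩
    have b := Set.mem_iInter.1 hx' ⟨i, hi⟩
    simp only [Set.mem_preimage, Set.mem_iUnion, Set.mem_singleton_iff, Metric.mem_ball,
      exists_prop] at a b
    obtain ⟨z, hz, hxz⟩ := a
    obtain ⟨z', hz', hxz'⟩ := b
    have hzz := hQδ z z' (hz.trans hz'.symm)
    have h1 := dist_triangle4 (T^[i] x) z z' (T^[i] x')
    rw [dist_comm z' _] at h1
    linarith
  refine measureReal_inter_preimage_le (hT.iterate (B j)) hO hq0 (fun f h _ hf1 hh hfO => ?_)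
    (fun x hx => ?_) (measurable_itinerary hT.measurable hQ _ (measurableSet_singleton A)) hD
  · let h' : C(I, ℝ) := h.comp ⟨_, hT.iterate (B j)⟩
    have h1 := hFH (f * h') (q • h') (fun x => mul_nonneg hq0 (hh _)) (fun p hp =>
      hp.integral_mul_le hT hq0 hf1 hh fun i hi x x' hx hx' =>
        hclose i hi x (hfO x hx) x' (hfO x' hx'))
    refine h1.trans (le_of_eq ?_)
    have h2 : ∫ x, h (T^[B j] x) ∂μ = ∫ x, h x ∂μ := by
      conv_rhs => rw [← (hinv.iterate (B j)).map_eq]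
      exact (integral_map (hT.iterate _).measurable.aemeasurable
        h.continuous.aestronglyMeasurable).symm
    rw [← h2, ← integral_const_mul]
    rfl
  · have hx : itinerary T Q (B j) x = A := hx
    refine Set.mem_iInter.2 fun i => ?_
    simp only [Set.mem_preimage, Set.mem_iUnion, Set.mem_singleton_iff, exists_prop]
    exact ⟨T^[i] x, congrFun hx i, Metric.mem_ball_self (by linarith [hδ j])⟩

/-! ### Horseshoes of interval maps with super-linear growth -/

theorem HasCovering.mono {X : Type*} [TopologicalSpace X] {T : X → X} {V W : Set X} {n : ℕ}
    {L L' : ℝ} (h : HasCovering T V W n L) (hL : L' ≤ L) : HasCovering T V W n L' := by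
  obtain ⟨ι, i, C, h1, h2⟩ := h
  exact ⟨ι, i, C, hL.trans h1, h2⟩

theorem HasCovering.refl {X : Type*} [TopologicalSpace X] {T : X → X} {V : Set X}
    (hV : IsClosed V) : HasCovering T V V 0 1 :=
  ⟨Unit, inferInstance, fun _ => V, by simp, fun _ => hV, fun _ => le_rfl, fun _ => by simp,
    fun a b h => absurd (Subsingleton.elim a b) h⟩

/-- The new branches are the parts of the old ones that follow a prescribed second branch after time
`n`; their numbers multiply. -/
theorem HasCovering.trans {X : Type*} [TopologicalSpace X] {T : X → X} (hT : Continuous T)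
    {U V W : Set X} {n n' : ℕ} {L L' : ℝ} (h : HasCovering T U V n L)
    (h' : HasCovering T V W n' L') (hL' : 0 ≤ L') : HasCovering T U W (n + n') (L * L') := by
  obtain ⟨ι, _, C, h1, h2, h3, h4, h5⟩ := h
  obtain ⟨ι', _, C', h1', h2', h3', h4', h5'⟩ := h'
  refine ⟨ι × ι', inferInstance, fun l => C l.1 ∩ T^[n] ⁻¹' C' l.2, ?_, fun l => ?_, fun l => ?_,
    fun l w hw => ?_, ?_⟩
  · rw [Fintype.card_prod]
    push_cast
    exact mul_le_mul h1 h1' hL' (Nat.cast_nonneg _)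
  · exact (h2 _).inter ((h2' _).preimage (hT.iterate n))
  · exact Set.inter_subset_left.trans (h3 _)
  · obtain ⟨v, hv, rfl⟩ := h4' l.2 hw
    obtain ⟨u, hu, rfl⟩ := h4 l.1 (h3' _ hv)
    exact ⟨u, ⟨hu, hv⟩, by rw [Nat.add_comm, Function.iterate_add_apply]⟩
  · intro l l' hl
    refine Set.disjoint_left.2 fun x hx hx' => ?_
    by_cases hl1 : l.1 = l'.1
    · have hl2 : l.2 ≠ l'.2 := fun h => hl (Prod.ext hl1 h)
      exact Set.disjoint_left.1 (h5' hl2) hx.2 hx'.2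
    · exact Set.disjoint_left.1 (h5 hl1) hx.1 hx'.1

theorem HasCovering.iterate {X ι : Type*} [TopologicalSpace X] {T : X → X} (hT : Continuous T)
    {G : ι → Set X} (hG : ∀ i, IsClosed (G i)) {φ : ι → ι} {n : ℕ} {a : ℝ}
    (h : ∀ i, HasCovering T (G i) (G (φ i)) n (Real.exp (a * n))) (r : ℕ) (i : ι) :
    HasCovering T (G i) (G (φ^[r] i)) (r * n) (Real.exp (a * (r * n : ℕ))) := by
  induction r generalizing i with
  | zero => simpa using HasCovering.refl (T := T) (hG i)
  | succ r ih =>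
    have := (h i).trans hT (ih (φ i)) (Real.exp_nonneg _)
    rw [← Real.exp_add] at this
    rw [Function.iterate_succ_apply]
    convert this using 2
    · ring
    · push_cast
      ring

/-- A family of sets, indexed by a finite type, each of which covers another one with super-linear
entropy, contains a set with horseshoes of super-linear entropy. -/
theorem exists_horseshoe_of_finite {X ι : Type*} [TopologicalSpace X] [Finite ι] [Nonempty ι]
    {T : X → X} (hT : Continuous T) {G : ι → Set X} (hG : ∀ i, IsClosed (G i))
    (h : ∀ R : ℕ, ∃ n ≥ 1, ∀ i, ∃ i', HasCovering T (G i) (G i') n (Real.exp (R * n))) :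
    ∃ i, ∀ R : ℕ, ∃ n ≥ 1, HasCovering T (G i) (G i) n (Real.exp (R * n)) := by
  have key : ∀ R : ℕ, ∃ i, ∃ n ≥ 1, HasCovering T (G i) (G i) n (Real.exp (R * n)) := by
    intro R
    obtain ⟨n, hn, hcov⟩ := h R
    choose φ hφ using hcov
    obtain ⟨x⟩ := ‹Nonempty ι›
    -- Following the coverings in a finite family closes a cycle. Composition along it preserves the
    -- rate `R` because all its coverings take the same time `n`.
    obtain ⟨a, b, hab, heq⟩ : ∃ a b : ℕ, a < b ∧ φ^[a] x = φ^[b] x := by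
      obtain ⟨a, b, hab, heq⟩ := Finite.exists_ne_map_eq_of_infinite fun r : ℕ => φ^[r] x
      rcases lt_or_gt_of_ne hab with h | h
      · exact ⟨a, b, h, heq⟩
      · exact ⟨b, a, h, heq.symm⟩
    refine ⟨φ^[a] x, (b - a) * n, Nat.mul_pos (Nat.sub_pos_of_lt hab) hn, ?_⟩
    have := HasCovering.iterate hT hG hφ (b - a) (φ^[a] x)
    rwa [← Function.iterate_add_apply, Nat.sub_add_cancel hab.le, ← heq] at this
  choose i hi using key
  -- The set may depend on `R`, but one of them occurs for arbitrarily large rates, and a larger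
  -- rate serves every smaller one.
  obtain ⟨i₀, hi₀⟩ := Finite.exists_infinite_fiber i
  have hinf : (i ⁻¹' {i₀}).Infinite := Set.infinite_coe_iff.1 hi₀
  refine ⟨i₀, fun R => ?_⟩
  obtain ⟨R', hR', hRR'⟩ := hinf.exists_gt R
  obtain ⟨n, hn, hcov⟩ := hi R'
  have hR' : i R' = i₀ := hR'
  rw [hR'] at hcov
  refine ⟨n, hn, hcov.mono (Real.exp_le_exp.2 ?_)⟩
  gcongr

/-- The set `S` contains an interval of length `ℓ`. -/
def ContainsInterval (ℓ : ℝ) (S : Set I) : Prop :=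
  ∃ a b : I, a ≤ b ∧ ℓ ≤ (b : ℝ) - a ∧ Set.Icc a b ⊆ S

theorem ContainsInterval.image {T : I → I} (hT : Continuous T) {K ε : ℝ}
    (h : ∀ a b : I, a ≤ b → (b : ℝ) - a ≤ ε → ∃ x ∈ Set.Icc a b, ∃ y ∈ Set.Icc a b,
      K * ((b : ℝ) - a) ≤ (T y : ℝ) - T x) {ℓ : ℝ} (hK : 0 ≤ K) (hℓ0 : 0 ≤ ℓ) (hℓ : ℓ ≤ ε) {S : Set I}
    (hS : ContainsInterval ℓ S) : ContainsInterval (K * ℓ) (T '' S) := by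
  obtain ⟨a, b, hab, hl, hsub⟩ := hS
  -- The expansion hypothesis covers only short intervals, so the interval is cut to length exactly
  -- `ℓ`. The intermediate value theorem then fills the interval between the two values.
  let b' : I := ⟨a + ℓ, by linarith [a.2.1], by linarith [b.2.2]⟩
  have hab' : a ≤ b' := Subtype.coe_le_coe.1 (by simp [b', hℓ0])
  have hbb' : b' ≤ b := Subtype.coe_le_coe.1 (by simp only [b']; linarith)
  have hlen : (b' : ℝ) - a = ℓ := by simp [b']
  obtain ⟨x, hx, y, hy, hxy⟩ := h a b' hab' (by rw [hlen]; exact hℓ)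
  rw [hlen] at hxy
  refine ⟨T x, T y, Subtype.coe_le_coe.1 (by nlinarith), hxy, ?_⟩
  have h1 : IsPreconnected (T '' Set.Icc a b') := isPreconnected_Icc.image T hT.continuousOn
  refine (h1.Icc_subset (Set.mem_image_of_mem T hx) (Set.mem_image_of_mem T hy)).trans ?_
  exact Set.image_mono ((Set.Icc_subset_Icc_right hbb').trans hsub)

theorem ContainsInterval.image_iterate {T : I → I} (hT : Continuous T) {K ε : ℝ}
    (h : ∀ a b : I, a ≤ b → (b : ℝ) - a ≤ ε → ∃ x ∈ Set.Icc a b, ∃ y ∈ Set.Icc a b,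
      K * ((b : ℝ) - a) ≤ (T y : ℝ) - T x) {ℓ : ℝ} (hK : 1 ≤ K) (hℓ0 : 0 ≤ ℓ) (m : ℕ)
    (hℓ : K ^ m * ℓ ≤ ε) {S : Set I} (hS : ContainsInterval ℓ S) :
    ContainsInterval (K ^ m * ℓ) (T^[m] '' S) := by
  have hK0 : 0 ≤ K := zero_le_one.trans hK
  induction m with
  | zero => simpa using hS
  | succ m ih =>
    have h1 : K ^ m * ℓ ≤ K ^ (m + 1) * ℓ :=
      mul_le_mul_of_nonneg_right (pow_le_pow_right₀ hK (Nat.le_succ m)) hℓ0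
    have := (ih (h1.trans hℓ)).image hT h hK0 (by positivity) (h1.trans hℓ)
    rw [Function.iterate_succ', Set.image_comp, pow_succ']
    rwa [← mul_assoc] at this

/-- Short intervals of length `ℓ` become long within a time `n` that is small compared with
`log (1 / ℓ)`. -/
theorem exists_uniform_growth {T : I → I} (hT : Continuous T)
    (h : ∀ K : ℝ, ∃ ε > 0, ∀ a b : I, a ≤ b → (b : ℝ) - a ≤ ε → ∃ x ∈ Set.Icc a b,
      ∃ y ∈ Set.Icc a b, K * ((b : ℝ) - a) ≤ (T y : ℝ) - T x) :
    ∃ ε > 0, ∀ R : ℕ, ∀ c > 0, ∃ n : ℕ, 1 ≤ n ∧ ∃ ℓ > 0, Real.exp (R * n) * ℓ ≤ c ∧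
      ∀ S : Set I, ContainsInterval ℓ S → ContainsInterval ε (T^[n] '' S) := by
  obtain ⟨ε, hε, h2⟩ := h 2
  refine ⟨ε, hε, fun R c hc => ?_⟩
  -- Growth proceeds in two stages: `m + 1` steps with factor `K` up to length `ℓ₀ ≤ ε'`, then `m'`
  -- doublings up to `ε`. Here `m'` is fixed before `m`, and the factor `2` in `K` leaves a surplus
  -- `2 ^ (m + 1)` that absorbs `exp (R * m') * ℓ₀ / c`.
  set K : ℝ := 2 * Real.exp R with hKdef
  obtain ⟨ε', hε', hK⟩ := h K
  have hK1 : 1 ≤ K := by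
    have := Real.one_le_exp (Nat.cast_nonneg (α := ℝ) R)
    linarith
  obtain ⟨m', hm'⟩ := pow_unbounded_of_one_lt (ε / ε') (one_lt_two : (1 : ℝ) < 2)
  set ℓ₀ := ε / 2 ^ m' with hℓ₀
  have hℓ₀pos : 0 < ℓ₀ := by positivity
  have hℓ₀ε : ℓ₀ ≤ ε' := by
    rw [hℓ₀, div_le_iff₀ (by positivity)]
    rw [div_lt_iff₀ hε'] at hm'
    linarith
  obtain ⟨m, hm⟩ := pow_unbounded_of_one_lt (Real.exp (R * m') * ℓ₀ / c) (one_lt_two : (1 : ℝ) < 2)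
  have hm1 : (2 : ℝ) ^ m ≤ 2 ^ (m + 1) := pow_le_pow_right₀ one_le_two (Nat.le_succ m)
  have hKm : K ^ (m + 1) = 2 ^ (m + 1) * Real.exp (R * (m + 1 : ℕ)) := by
    rw [hKdef, mul_pow, ← Real.exp_nat_mul, mul_comm (R : ℝ)]
  have hKpos : 0 < K ^ (m + 1) := by positivity
  refine ⟨m + 1 + m', by omega, ℓ₀ / K ^ (m + 1), by positivity, ?_, fun S hS => ?_⟩
  · rw [hKm]
    push_cast
    rw [mul_add, Real.exp_add, mul_div_assoc', div_le_iff₀ (by positivity)]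
    rw [div_lt_iff₀ hc] at hm
    have h1 : Real.exp (R * m') * ℓ₀ ≤ 2 ^ (m + 1) * c :=
      hm.le.trans (mul_le_mul_of_nonneg_right hm1 hc.le)
    have h3 := mul_le_mul_of_nonneg_left h1 (Real.exp_nonneg (R * ((m : ℝ) + 1)))
    linarith
  · have e1 : K ^ (m + 1) * (ℓ₀ / K ^ (m + 1)) = ℓ₀ := mul_div_cancel₀ _ hKpos.ne'
    have s1 := hS.image_iterate hT hK hK1 (by positivity) (m + 1) (by rw [e1]; exact hℓ₀ε)
    rw [e1] at s1
    have e2 : 2 ^ m' * ℓ₀ = ε := mul_div_cancel₀ _ (by positivity)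
    have s2 := s1.image_iterate hT h2 one_le_two hℓ₀pos.le m' e2.le
    rw [e2, ← Set.image_comp, ← Function.iterate_add, Nat.add_comm] at s2
    exact s2

/-- The cells of the uniform grid with `N` cells. -/
def gridCell (N : ℕ) (i : Fin N) : Set I := {x | (i : ℝ) / N ≤ x ∧ (x : ℝ) ≤ ((i : ℝ) + 1) / N}

theorem isClosed_gridCell (N : ℕ) (i : Fin N) : IsClosed (gridCell N i) :=
  (isClosed_le continuous_const continuous_subtype_val).inter
    (isClosed_le continuous_subtype_val continuous_const)

theorem gridCell_nonempty (N : ℕ) (i : Fin N) : (gridCell N i).Nonempty := by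
  have hN : (0 : ℝ) < N := by exact_mod_cast i.pos
  have hi : (i : ℝ) + 1 ≤ N := by exact_mod_cast i.2
  refine ⟨⟨(i : ℝ) / N, by positivity, ?_⟩, le_rfl, ?_⟩
  · rw [div_le_one hN]
    linarith
  · show (i : ℝ) / N ≤ _
    gcongr
    linarith

theorem ContainsInterval.exists_gridCell_subset {ε : ℝ} {N : ℕ} (hN : 0 < N) (hε : 2 / N ≤ ε)
    {S : Set I} (hS : ContainsInterval ε S) : ∃ i, gridCell N i ⊆ S := by
  obtain ⟨a, b, -, hl, hsub⟩ := hS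
  have hNR : (0 : ℝ) < N := by exact_mod_cast hN
  have h1 := Nat.le_ceil ((a : ℝ) * N)
  have h2 := Nat.ceil_lt_add_one (mul_nonneg a.2.1 hNR.le)
  have h3 : 2 ≤ ((b : ℝ) - a) * N := by
    rw [← div_le_iff₀ hNR]
    exact hε.trans hl
  have h4 : (⌈(a : ℝ) * N⌉₊ : ℝ) + 1 ≤ b * N := by linarith
  have h5 : (b : ℝ) * N ≤ N := mul_le_of_le_one_left hNR.le b.2.2
  have h6 : ⌈(a : ℝ) * N⌉₊ < N := by
    have : (⌈(a : ℝ) * N⌉₊ : ℝ) < N := by linarith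
    exact_mod_cast this
  refine ⟨⟨_, h6⟩, fun x hx => hsub ⟨Subtype.coe_le_coe.1 ?_, Subtype.coe_le_coe.1 ?_⟩⟩
  · refine le_trans ?_ hx.1
    rwa [le_div_iff₀ hNR]
  · refine hx.2.trans ?_
    rwa [div_le_iff₀ hNR]

/-- A cell holds about `1 / (2 * N * ℓ)` intervals of length `ℓ` separated by gaps of length `ℓ`.
Each covers some cell, and by the pigeonhole principle at least a fraction `1 / N` of them cover the
same one. -/
theorem exists_covering_gridCell {T : I → I} {N n : ℕ} (i : Fin N) {ℓ : ℝ} (hℓ : 0 < ℓ)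
    (hℓN : 4 * N * ℓ ≤ 1)
    (h : ∀ S : Set I, ContainsInterval ℓ S → ∃ i', gridCell N i' ⊆ T^[n] '' S) :
    ∃ i', HasCovering T (gridCell N i) (gridCell N i') n (1 / (4 * N ^ 2 * ℓ)) := by
  have hN : (0 : ℝ) < N := by exact_mod_cast i.pos
  have hi : (i : ℝ) + 1 ≤ N := by exact_mod_cast i.2
  set P : ℕ := ⌊1 / (2 * N * ℓ)⌋₊ with hP
  have hP1 : (P : ℝ) * (2 * ℓ) ≤ 1 / N := by
    have h1 : (P : ℝ) ≤ 1 / (2 * N * ℓ) := Nat.floor_le (by positivity)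
    calc (P : ℝ) * (2 * ℓ) ≤ 1 / (2 * N * ℓ) * (2 * ℓ) := by gcongr
      _ = 1 / N := by field_simp
  -- Since `1 / (2 * N * ℓ) ≥ 2`, rounding down loses at most half.
  have hP2 : 1 / (4 * N * ℓ) ≤ P := by
    have h1 := Nat.lt_floor_add_one (1 / (2 * N * ℓ))
    have h2 : 1 / (2 * N * ℓ) = 2 * (1 / (4 * N * ℓ)) := by field_simp; norm_num
    have h3 : 1 ≤ 1 / (4 * N * ℓ) := by rwa [le_div_iff₀ (by positivity), one_mul]
    rw [← hP] at h1
    linarith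
  let C : Fin P → Set I := fun t =>
    {x | (i : ℝ) / N + t * (2 * ℓ) ≤ x ∧ (x : ℝ) ≤ (i : ℝ) / N + t * (2 * ℓ) + ℓ}
  have hCle : ∀ t : Fin P, (i : ℝ) / N + t * (2 * ℓ) + ℓ ≤ ((i : ℝ) + 1) / N := by
    intro t
    have h1 : (t : ℝ) + 1 ≤ P := by exact_mod_cast t.2
    have h2 := mul_le_mul_of_nonneg_right h1 (by positivity : 0 ≤ 2 * ℓ)
    rw [add_div]
    linarith
  have hi1 : ((i : ℝ) + 1) / N ≤ 1 := by rwa [div_le_one hN]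
  have hCint : ∀ t, ContainsInterval ℓ (C t) := by
    intro t
    have h1 := hCle t
    have h0 : 0 ≤ (i : ℝ) / N + t * (2 * ℓ) := by positivity
    refine ⟨⟨(i : ℝ) / N + t * (2 * ℓ), h0, by linarith⟩,
      ⟨(i : ℝ) / N + t * (2 * ℓ) + ℓ, by linarith, by linarith⟩, ?_, ?_, ?_⟩
    · exact Subtype.mk_le_mk.2 (by linarith)
    · simp
    · exact fun x hx => ⟨hx.1, hx.2⟩
  choose φ hφ using fun t => h (C t) (hCint t)
  have : Nonempty (Fin N) := ⟨i⟩
  obtain ⟨i', hi'⟩ := Fintype.exists_le_card_fiber_of_nsmul_le_card φ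
    (b := 1 / (4 * (N : ℝ) ^ 2 * ℓ)) (by
      rw [Fintype.card_fin, Fintype.card_fin, nsmul_eq_mul]
      refine le_trans (le_of_eq ?_) hP2
      field_simp)
  refine ⟨i', {t // φ t = i'}, inferInstance, fun t => C t, ?_, fun t => ?_, fun t x hx => ⟨?_, ?_⟩,
    fun t => ?_, ?_⟩
  · rwa [Fintype.card_subtype]
  · exact (isClosed_le continuous_const continuous_subtype_val).inter
      (isClosed_le continuous_subtype_val continuous_const)
  · refine le_trans ?_ hx.1
    have : (0 : ℝ) ≤ (t : Fin P) * (2 * ℓ) := by positivity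
    linarith
  · exact hx.2.trans (hCle t)
  · have := hφ t
    rwa [t.2] at this
  · intro t t' htt
    have key : ∀ s s' : Fin P, s < s' → Disjoint (C s) (C s') := by
      intro s s' hs
      refine Set.disjoint_left.2 fun x hx hx' => ?_
      have h1 : (s : ℝ) + 1 ≤ s' := by exact_mod_cast hs
      have h2 := mul_le_mul_of_nonneg_right h1 (by positivity : 0 ≤ 2 * ℓ)
      have h3 := hx.2
      have h4 := hx'.1
      linarith
    have htt' : (t : Fin P) ≠ t' := fun h => htt (Subtype.ext h)
    rcases lt_or_gt_of_ne htt' with h | h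
    · exact key _ _ h
    · exact (key _ _ h).symm

/-- An interval map with super-linear growth has horseshoes of super-linear entropy. -/
theorem exists_horseshoe_of_growth {T : I → I} (hT : Continuous T)
    (h : ∀ K : ℝ, ∃ ε > 0, ∀ a b : I, a ≤ b → (b : ℝ) - a ≤ ε → ∃ x ∈ Set.Icc a b,
      ∃ y ∈ Set.Icc a b, K * ((b : ℝ) - a) ≤ (T y : ℝ) - T x) :
    ∃ V : Set I, V.Nonempty ∧ ∀ R : ℕ, ∃ n ≥ 1, HasCovering T V V n (Real.exp (R * n)) := by
  obtain ⟨ε, hε, hgrow⟩ := exists_uniform_growth hT h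
  obtain ⟨N, hN⟩ := exists_nat_gt (max 1 (2 / ε))
  have hNR : (0 : ℝ) < N := lt_trans (by positivity) hN
  have hN0 : 0 < N := by exact_mod_cast hNR
  have hNε : 2 / (N : ℝ) ≤ ε := by
    have := (le_max_right 1 (2 / ε)).trans hN.le
    rw [div_le_iff₀ hε] at this
    rw [div_le_iff₀ hNR]
    linarith
  have : Nonempty (Fin N) := ⟨⟨0, hN0⟩⟩
  obtain ⟨i, hi⟩ := exists_horseshoe_of_finite hT (isClosed_gridCell N) (fun R => by
    obtain ⟨n, hn, ℓ, hℓ, hexp, hS⟩ := hgrow R (1 / (4 * N ^ 2)) (by positivity)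
    refine ⟨n, hn, fun i => ?_⟩
    have hN1 : (1 : ℝ) ≤ N := by exact_mod_cast hN0
    rw [le_div_iff₀ (by positivity)] at hexp
    have hexp1 : 1 ≤ Real.exp (R * n) := Real.one_le_exp (by positivity)
    have hℓN : 4 * N * ℓ ≤ 1 := by
      calc 4 * N * ℓ = 1 * ℓ * (4 * N * 1) := by ring
        _ ≤ Real.exp (R * n) * ℓ * (4 * N * N) := by gcongr
        _ = Real.exp (R * n) * ℓ * (4 * N ^ 2) := by ring
        _ ≤ 1 := hexp
    obtain ⟨i', hi'⟩ := exists_covering_gridCell i hℓ hℓN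
      (fun S hSl => (hS S hSl).exists_gridCell_subset hN0 hNε)
    refine ⟨i', hi'.mono ?_⟩
    rw [le_div_iff₀ (by positivity)]
    linarith)
  exact ⟨gridCell N i, gridCell_nonempty N i, hi⟩

/-! ### Zipper maps: steep increments at all scales -/

/-- A function on `[0,1]` that reproduces itself affinely on the pieces of a subdivision, with
slope ratios at least `lam`, has steep increments at every scale and every place. -/
theorem exists_steep_increment {f : ℝ → ℝ} {umin umax lam : ℝ} (hu : 0 < umin)
    (hlam : 0 ≤ lam) (h0 : f 0 = 0) (h1 : f 1 = 1)
    (h : ∀ z ∈ Set.Icc (0 : ℝ) 1, ∃ c u d v : ℝ, ∃ z' ∈ Set.Icc (0 : ℝ) 1,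
      0 ≤ c ∧ c + u ≤ 1 ∧ umin ≤ u ∧ u ≤ umax ∧ lam * u ≤ |v| ∧ z = c + u * z' ∧
      ∀ w ∈ Set.Icc (0 : ℝ) 1, f (c + u * w) = d + v * f w)
    (M : ℕ) : ∀ z ∈ Set.Icc (0 : ℝ) 1, ∀ r ≤ 1, umax ^ M ≤ r → ∃ n : ℕ, ∃ a b : ℝ,
      0 ≤ a ∧ a ≤ z ∧ z ≤ b ∧ b ≤ 1 ∧ umin * r ≤ b - a ∧ b - a ≤ r ∧ umin ^ n ≤ b - a ∧
      lam ^ n * (b - a) ≤ |f a - f b| := by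
  have hle : umin ≤ 1 := by
    obtain ⟨c, u, d, v, z', hz', hc, hcu, hu1, -⟩ := h 0 (by simp)
    linarith
  induction M with
  | zero =>
    intro z hz r hr1 hr
    have : r = 1 := le_antisymm hr1 (by simpa using hr)
    subst this
    exact ⟨0, 0, 1, le_rfl, hz.1, hz.2, le_rfl, by simpa using hle, by simp, by simp,
      by simp [h0, h1]⟩
  | succ M ih =>
    intro z hz r hr1 hr
    obtain ⟨c, u, d, v, z', hz', hc, hcu, hu1, hu2, hv, rfl, hf⟩ := h z hz
    have hu0 : 0 < u := hu.trans_le hu1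
    -- If the piece around `z` is longer than `r`, the problem is rescaled into it, which adds one
    -- level of depth and multiplies the slope by at least `lam`. Otherwise the piece itself serves:
    -- `umin * r ≤ umin ≤ u < r`.
    rcases le_or_gt r u with hru | hru
    · have hM : umax ^ M ≤ r / u := by
        rw [le_div_iff₀ hu0]
        refine le_trans ?_ hr
        rw [pow_succ]
        exact mul_le_mul_of_nonneg_left hu2 (pow_nonneg (hu0.le.trans hu2) _)
      obtain ⟨n, a, b, ha, haz, hzb, hb, hl, hl', hn, hfab⟩ :=
        ih z' hz' (r / u) ((div_le_one hu0).2 hru) hM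
      have hlen : c + u * b - (c + u * a) = u * (b - a) := by ring
      have hba : 0 ≤ b - a := by linarith
      refine ⟨n + 1, c + u * a, c + u * b, by positivity, ?_, ?_, ?_, ?_, ?_, ?_, ?_⟩
      · gcongr
      · gcongr
      · nlinarith
      · rw [hlen]
        calc umin * r = u * (umin * (r / u)) := by field_simp
          _ ≤ u * (b - a) := by gcongr
      · rw [hlen]
        calc u * (b - a) ≤ u * (r / u) := by gcongr
          _ = r := by field_simp
      · rw [hlen, pow_succ, mul_comm]
        gcongr
      · rw [hlen, hf a ⟨ha, by linarith⟩, hf b ⟨by linarith, hb⟩,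
          show d + v * f a - (d + v * f b) = v * (f a - f b) by ring, abs_mul]
        calc lam ^ (n + 1) * (u * (b - a)) = lam * u * (lam ^ n * (b - a)) := by ring
          _ ≤ |v| * |f a - f b| := by gcongr
    · have e0 := hf 0 (by simp)
      have e1 := hf 1 (by simp)
      rw [mul_zero, add_zero, h0, mul_zero, add_zero] at e0
      rw [mul_one, h1, mul_one] at e1
      refine ⟨1, c, c + u, hc, ?_, ?_, hcu, ?_, ?_, ?_, ?_⟩
      · nlinarith [hz'.1]
      · nlinarith [hz'.2]
      · nlinarith
      · linarith
      · simpa using hu1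
      · rw [e0, e1]
        simpa [abs_neg] using hv

/-! ### Self-similarity and expansion of the zipper map -/

namespace ZipperParam

variable (p : ZipperParam)

theorem zipperMap_zero : p.zipperMap 0 = 0 :=
  (ContractingWith.fixedPoint p.phi p.contracting_phi).2.1

theorem zipperMap_one : p.zipperMap 1 = 1 :=
  (ContractingWith.fixedPoint p.phi p.contracting_phi).2.2

theorem ev_coe (f : I → I) (x : I) : ev f x = f x := by
  simp [ev]

theorem ev_zipperMap {t : ℝ} (ht : t ∈ Set.Icc (0 : ℝ) 1) :
    ev p.zipperMap t = p.phiFun p.zipperMap t := by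
  rw [← p.zipperMap_apply ⟨t, ht⟩, ← ev_coe]

theorem ev_zipperMap_left {w : ℝ} (hw : w ∈ Set.Icc (0 : ℝ) 1) :
    ev p.zipperMap (0 + p.x1 * w) = 0 + p.y1 * ev p.zipperMap w := by
  have h1 := p.x1_pos
  have h2 := p.x1_lt_x2
  have h3 := p.x2_lt_one
  have hle : 0 + p.x1 * w ≤ p.x1 := by nlinarith [hw.2]
  rw [ev_zipperMap p ⟨by nlinarith [hw.1], by linarith⟩, phiFun, if_pos hle, zero_add, zero_add,
    mul_div_cancel_left₀ _ h1.ne']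

theorem ev_zipperMap_middle {w : ℝ} (hw : w ∈ Set.Icc (0 : ℝ) 1) :
    ev p.zipperMap (p.x1 + (p.x2 - p.x1) * w) =
      p.y1 + -(p.y1 - p.y2) * ev p.zipperMap w := by
  have h1 := p.x1_pos
  have h2 := p.x1_lt_x2
  have h3 := p.x2_lt_one
  -- At `w = 0` the definition uses the left piece; the two formulas agree there because `Z_p` fixes
  -- `0` and `1`.
  rcases hw.1.eq_or_lt with rfl | hw0
  · have := ev_zipperMap_left p (w := 1) (by simp)
    rw [ev_one _ p.zipperMap_one, zero_add, mul_one] at this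
    rw [mul_zero, add_zero, this, ev_zero _ p.zipperMap_zero]
    ring
  have hle : p.x1 + (p.x2 - p.x1) * w ≤ p.x2 := by nlinarith [hw.2]
  have hgt : ¬ p.x1 + (p.x2 - p.x1) * w ≤ p.x1 := by nlinarith
  rw [ev_zipperMap p ⟨by nlinarith, by linarith⟩, phiFun, if_neg hgt, if_pos hle,
    add_sub_cancel_left, mul_div_cancel_left₀ _ (sub_pos.2 h2).ne']
  ring

theorem ev_zipperMap_right {w : ℝ} (hw : w ∈ Set.Icc (0 : ℝ) 1) :
    ev p.zipperMap (p.x2 + (1 - p.x2) * w) = p.y2 + (1 - p.y2) * ev p.zipperMap w := by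
  have h1 := p.x1_pos
  have h2 := p.x1_lt_x2
  have h3 := p.x2_lt_one
  rcases hw.1.eq_or_lt with rfl | hw0
  · have := ev_zipperMap_middle p (w := 1) (by simp)
    rw [ev_one _ p.zipperMap_one, mul_one, add_sub_cancel] at this
    rw [mul_zero, add_zero, this, ev_zero _ p.zipperMap_zero]
    ring
  have hgt : ¬ p.x2 + (1 - p.x2) * w ≤ p.x2 := by nlinarith
  have hgt' : ¬ p.x2 + (1 - p.x2) * w ≤ p.x1 := by nlinarith
  rw [ev_zipperMap p ⟨by nlinarith, by nlinarith [hw.2]⟩, phiFun, if_neg hgt', if_neg hgt,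
    add_sub_cancel_left, mul_div_cancel_left₀ _ (sub_pos.2 h3).ne']

/-- Every point of `[0,1]` lies in one of the three pieces, on which `Z_p` reproduces itself. -/
theorem exists_piece {z : ℝ} (hz : z ∈ Set.Icc (0 : ℝ) 1) :
    ∃ c u d v : ℝ, ∃ z' ∈ Set.Icc (0 : ℝ) 1, 0 ≤ c ∧ c + u ≤ 1 ∧
      min p.x1 (min (p.x2 - p.x1) (1 - p.x2)) ≤ u ∧
      u ≤ max p.x1 (max (p.x2 - p.x1) (1 - p.x2)) ∧ p.lambdaMin * u ≤ |v| ∧ z = c + u * z' ∧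
      ∀ w ∈ Set.Icc (0 : ℝ) 1, ev p.zipperMap (c + u * w) = d + v * ev p.zipperMap w := by
  have h1 := p.x1_pos
  have h2 := p.x1_lt_x2
  have h3 := p.x2_lt_one
  have k1 := p.y2_pos
  have k2 := p.y2_lt_y1
  have k3 := p.y1_lt_one
  rcases le_or_gt z p.x1 with hz1 | hz1
  · refine ⟨0, p.x1, 0, p.y1, z / p.x1, ⟨div_nonneg hz.1 h1.le, (div_le_one h1).2 hz1⟩, le_rfl,
      by linarith, min_le_left _ _, le_max_left _ _, ?_, ?_, fun w => p.ev_zipperMap_left⟩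
    · rw [abs_of_nonneg (by linarith), ← le_div_iff₀ h1]
      exact min_le_left _ _
    · rw [mul_div_cancel₀ _ h1.ne', zero_add]
  rcases le_or_gt z p.x2 with hz2 | hz2
  · have h2' := sub_pos.2 h2
    refine ⟨p.x1, p.x2 - p.x1, p.y1, -(p.y1 - p.y2), (z - p.x1) / (p.x2 - p.x1),
      ⟨div_nonneg (by linarith) h2'.le, (div_le_one h2').2 (by linarith)⟩, h1.le,
      by linarith, (min_le_right _ _).trans (min_le_left _ _),
      (le_max_left _ _).trans (le_max_right _ _), ?_, ?_, fun w => p.ev_zipperMap_middle⟩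
    · rw [abs_neg, abs_of_nonneg (by linarith), ← le_div_iff₀ h2']
      exact (min_le_right _ _).trans (min_le_left _ _)
    · rw [mul_div_cancel₀ _ h2'.ne', add_sub_cancel]
  · have h3' := sub_pos.2 h3
    refine ⟨p.x2, 1 - p.x2, p.y2, 1 - p.y2, (z - p.x2) / (1 - p.x2),
      ⟨div_nonneg (by linarith) h3'.le, (div_le_one h3').2 (by linarith [hz.2])⟩, by linarith,
      by linarith, (min_le_right _ _).trans (min_le_right _ _),
      (le_max_right _ _).trans (le_max_right _ _), ?_, ?_, fun w => p.ev_zipperMap_right⟩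
    · rw [abs_of_nonneg (by linarith), ← le_div_iff₀ h3']
      exact (min_le_right _ _).trans (min_le_right _ _)
    · rw [mul_div_cancel₀ _ h3'.ne', add_sub_cancel]

variable {p}

/-- A hypersensitive zipper map has arbitrarily steep increments on all short intervals. -/
theorem Hypersensitive.exists_growth (hp : p.Hypersensitive) (K : ℝ) :
    ∃ ε > 0, ∀ a b : I, a ≤ b → (b : ℝ) - a ≤ ε → ∃ x ∈ Set.Icc a b, ∃ y ∈ Set.Icc a b,
      K * ((b : ℝ) - a) ≤ (p.zipperMap y : ℝ) - p.zipperMap x := by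
  have h1 := p.x1_pos
  have h2 := p.x1_lt_x2
  have h3 := p.x2_lt_one
  set umin := min p.x1 (min (p.x2 - p.x1) (1 - p.x2)) with humin
  set umax := max p.x1 (max (p.x2 - p.x1) (1 - p.x2)) with humax
  have hmin0 : 0 < umin := lt_min h1 (lt_min (by linarith) (by linarith))
  have hmin1 : umin < 1 := (min_le_left _ _).trans_lt (by linarith)
  have hmax1 : umax < 1 := max_lt (by linarith) (max_lt (by linarith) (by linarith))
  have hlam : 1 < p.lambdaMin := hp
  obtain ⟨N, hN⟩ := pow_unbounded_of_one_lt (2 * K / umin) hlam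
  refine ⟨umin ^ N, pow_pos hmin0 _, fun a b hab hε => ?_⟩
  rcases hab.eq_or_lt with rfl | hab
  · exact ⟨a, Set.left_mem_Icc.2 le_rfl, a, Set.left_mem_Icc.2 le_rfl, by simp⟩
  have hab' : (a : ℝ) < b := hab
  have ha := a.2
  have hb := b.2
  -- A piece of length at most `(b - a) / 2` containing the midpoint lies inside `[a, b]`.
  obtain ⟨M, hM⟩ := exists_pow_lt_of_lt_one (show 0 < ((b : ℝ) - a) / 2 by linarith) hmax1
  obtain ⟨n, s, t, hs0, hsz, hzt, ht1, hl, hl', hn, hst⟩ :=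
    exists_steep_increment hmin0 (by linarith) (ev_zero _ p.zipperMap_zero)
      (ev_one _ p.zipperMap_one) (fun z hz => p.exists_piece hz) M (((a : ℝ) + b) / 2)
      ⟨by linarith [ha.1, hb.1], by linarith [ha.2, hb.2]⟩ (((b : ℝ) - a) / 2)
      (by linarith [ha.1, hb.2]) hM.le
  -- A piece of depth `n` has length at least `umin ^ n`, so a piece shorter than `umin ^ N` has
  -- depth at least `N`. The choice of `N` then absorbs the loss `umin / 2` in length.
  have hNn : N ≤ n := by
    by_contra! hlt
    have := pow_lt_pow_right_of_lt_one₀ hmin0 hmin1 hlt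
    linarith
  have hgrow : K * ((b : ℝ) - a) ≤ |ev p.zipperMap s - ev p.zipperMap t| := by
    rw [div_lt_iff₀ hmin0] at hN
    calc K * ((b : ℝ) - a) = 2 * K * (((b : ℝ) - a) / 2) := by ring
      _ ≤ p.lambdaMin ^ N * umin * (((b : ℝ) - a) / 2) := by
        gcongr
      _ = p.lambdaMin ^ N * (umin * (((b : ℝ) - a) / 2)) := by ring
      _ ≤ p.lambdaMin ^ n * (t - s) := by
        gcongr
        exact hlam.le
      _ ≤ _ := hst
  have hs : s ∈ Set.Icc (0 : ℝ) 1 := ⟨hs0, by linarith⟩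
  have ht : t ∈ Set.Icc (0 : ℝ) 1 := ⟨by linarith, ht1⟩
  have es := ev_coe p.zipperMap ⟨s, hs⟩
  have et := ev_coe p.zipperMap ⟨t, ht⟩
  simp only at es et
  rw [es, et] at hgrow
  have hsm : (⟨s, hs⟩ : I) ∈ Set.Icc a b :=
    ⟨Subtype.coe_le_coe.1 (by simp only; linarith), Subtype.coe_le_coe.1 (by simp only; linarith)⟩
  have htm : (⟨t, ht⟩ : I) ∈ Set.Icc a b :=
    ⟨Subtype.coe_le_coe.1 (by simp only; linarith), Subtype.coe_le_coe.1 (by simp only; linarith)⟩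
  rcases le_abs.1 hgrow with hg | hg
  · exact ⟨_, htm, _, hsm, hg⟩
  · exact ⟨_, hsm, _, htm, by linarith⟩

end ZipperParam

/-- Every hypersensitive zipper map admits an invariant Borel probability measure with positive
Kolmogorov-Sinai mean dimension. -/
theorem corollaryc (p : ZipperParam) (hp : p.Hypersensitive) :
    ∃ μ : Measure unitInterval, IsProbabilityMeasure μ ∧
      MeasurePreserving p.zipperMap μ μ ∧ 0 < ksMeanDim p.zipperMap μ := by
  obtain ⟨V, hV, hcov⟩ := exists_horseshoe_of_growth p.zipperMap.continuous hp.exists_growth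
  obtain ⟨μ, hμ, hT, hspread⟩ := exists_hasSpreadFibres p.zipperMap.continuous hV hcov
  exact ⟨μ, hμ, hT, hspread.ksMeanDim_pos hT⟩
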